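/- Let $N\in\mathbb N$, let $b:\mathbb R^N\to\mathbb R^N$ be Lipschitz continuous and $C^1$, and for $1\le i\le N$ let $a_i:\mathbb R^N\to\mathbb R^N$ be $C^1$ and $f_i:\mathbb R^N\to(0,\infty)$ be Lipschitz continuous. Let $\gamma_t(x)$ be the flow of $b$, i.e. $\gamma_t(x)=x+\int_0^t b(\gamma_s(x))\,ds$, put $\bar f=\sum_{i=1}^N f_i$, $\Delta_i(x)=x+a_i(x)$, and suppose that $\int_0^\infty \bar f(\gamma_s(x))\,ds=\infty$ for all $x\in\mathbb R^N$. Let $X$ be the piecewise deterministic Markov process that follows $\gamma$ between jumps, jumps at rate $\bar f(X_t)$, and goes at a jump from $y$ to $\Delta_i(y)$ with probability $f_i(y)/\bar f(y)$ (jump of particle $i$; its generator is $Lg(x)=\sum_{i} f_i(x)[g(\Delta_i(x))-g(x)]+\langle\nabla g(x),b(x)\rangle$). Let $T_0=0<T_1<T_2<\dots$ be its successive jump times, a jump from $Z_0$ taking place at time $T_0=0$, let $Z_k=X_{T_k-}$ be the jump chain, $K$ its transition kernel ($K(z,\cdot)$ is the law of $Z_1$ given $Z_0=z$), and $K^m$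 the $m$-fold iterate of $K$. For $n\ge 0$, indices $\mathbf i=(i_0,\dots,i_n)\in\{1,\dots,N\}^{n+1}$, times $\mathbf t=(t_1,\dots,t_{n+1})\in[0,\infty)^{n+1}$ and $x_0\in\mathbb R^N$ put $x_{k+1}=\Delta_{i_{k+1}}(\gamma_{t_{k+1}}(x_k))$ for $0\le k<n$ and $\eta(x_0,\mathbf t,\mathbf i)=\gamma_{t_{n+1}}(x_n)$, and let $$\sigma(x_0,\mathbf t,\mathbf i)=\big(\partial_{t_j}\eta^k(x_0,\mathbf t,\mathbf i)\big)_{1\le k\le N,\ 1\le j\le n+1}\in\mathbb R^{N\times(n+1)},$$ with one-sided derivatives at $t_j=0$. Suppose that for some $n$ and some $\mathbf i$ $$\inf_{x_0\in\mathbb R^N}\det\big(\sigma\sigma^T(x_0,\mathbf 0,\mathbf i)\big)>0 .$$ Then for every $z_0\in\mathbb R^N$ there exist $z_n\in\mathbb R^N$, $\delta_1,\delta_2>0$, $\beta\in\,]0,1[$ and a $C^\infty$ probability density $\nu$ on $\mathbb R^N$ with compact support contained in the open ball $B_{\delta_2}(z_n)$ such that, with $C=B_{\delta_1}(z_0)$,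 $$K^{n+1}(x,B)\ \ge\ \beta\,1_C(x)\int_B\nu(y)\,dy\qquad\text{for all }x\in\mathbb R^N\text{ and all Borel sets }B\subset\mathbb R^N .$$ -/

import Mathlib

open MeasureTheory ProbabilityTheory Set
open scoped ENNReal NNReal ContDiff

namespace JumpPDMP

/-- Configurations of `N` particles: `ℝ^N` with the Euclidean norm and Lebesgue measure. -/
abbrev Conf (N : ℕ) : Type := EuclideanSpace ℝ (Fin N)

noncomputable section

/-! ### Coefficients and deterministic flow -/

/-- `u` is the trajectory of `u' = b(u)` with `u 0 = x`. For a Lipschitz drift there is exactly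
one, and it is defined for all times. -/
def IsTrajectory {N : ℕ} (b : Conf N → Conf N) (x : Conf N) (u : ℝ → Conf N) : Prop :=
  u 0 = x ∧ ∀ t : ℝ, HasDerivAt u (b (u t)) t

/-- The flow `γ_t(x)` of the drift `b`. -/
def flow {N : ℕ} (b : Conf N → Conf N) (t : ℝ) (x : Conf N) : Conf N :=
  Classical.epsilon (IsTrajectory b x) t

/-- `Δ_i(x) = x + a_i(x)`, the configuration right after a jump of particle `i`. -/
def afterJump {N : ℕ} (a : Fin N → Conf N → Conf N) (i : Fin N) (x : Conf N) : Conf N :=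
  x + a i x

/-- The total jump rate. -/
def totalRate {N : ℕ} (f : Fin N → Conf N → ℝ) (x : Conf N) : ℝ :=
  ∑ i, f i x

/-! ### The piecewise deterministic Markov process

The process follows the flow of `b` between jumps, jumps at rate `totalRate f` (evaluated along
the trajectory), and a jump from `y` is a jump of particle `i` with probability
`f i y / totalRate f y`, leading to `Δ_i(y)`. It is built from i.i.d. pairs `(ξ_k, v_k)`, with
`ξ_k` standard exponential and `v_k` uniform on `[0,1]`. -/

/-- The driving noise `((ξ_k, v_k))_k`. -/
abbrev Noise : Type := ℕ → ℝ × unitInterval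

/-- The law of the driving noise. -/
def noiseLaw : Measure Noise :=
  Measure.infinitePi fun _ : ℕ => (expMeasure 1).prod (volume : Measure unitInterval)

/-- The configuration after a jump from `y`, with `v` uniform on `[0,1]` choosing the jumping
particle: particle `i` jumps when `v * totalRate f y` falls into the `i`-th of the consecutive
intervals of lengths `f 0 y, f 1 y, …`. -/
def jumpFrom {N : ℕ} (a : Fin N → Conf N → Conf N) (f : Fin N → Conf N → ℝ)
    (y : Conf N) (v : ℝ) : Conf N :=
  y + ∑ i, ({w : ℝ | ∑ j ∈ Finset.Iio i, f j y < w ∧ w ≤ ∑ j ∈ Finset.Iic i, f j y}).indicator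
    (fun _ => a i y) (v * totalRate f y)

/-- The waiting time until the next jump after a jump to `x`: the first time at which the
integrated jump rate along the flow reaches the level `ξ`. For `ξ` standard exponential it exceeds
`t` with probability `exp (- ∫_0^t totalRate f (γ_s x) ds)`. -/
def waitingTime {N : ℕ} (b : Conf N → Conf N) (f : Fin N → Conf N → ℝ)
    (x : Conf N) (ξ : ℝ) : ℝ :=
  sInf {t : ℝ | 0 ≤ t ∧ ξ ≤ ∫ s in (0 : ℝ)..t, totalRate f (flow b s x)}

/-- The pair `(T_k, X_{T_k})` of the `k`-th jump time and the configuration right after that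
jump, when a jump occurs from the configuration `z` at time `T_0 = 0`. -/
def jumpRecord {N : ℕ} (b : Conf N → Conf N) (a : Fin N → Conf N → Conf N)
    (f : Fin N → Conf N → ℝ) (z : Conf N) (ζ : Noise) : ℕ → ℝ × Conf N
  | 0 => (0, jumpFrom a f z (ζ 0).2)
  | k + 1 =>
    let r := jumpRecord b a f z ζ k
    let s := waitingTime b f r.2 (ζ (k + 1)).1
    (r.1 + s, jumpFrom a f (flow b s r.2) (ζ (k + 1)).2)

/-- The jump times `0 = T_0 < T_1 < T_2 < …`. -/
def jumpTime {N : ℕ} (b : Conf N → Conf N) (a : Fin N → Conf N → Conf N)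
    (f : Fin N → Conf N → ℝ) (z : Conf N) (k : ℕ) (ζ : Noise) : ℝ :=
  (jumpRecord b a f z ζ k).1

/-- The process `X_t` with a jump from `z` at time `0` (and `X_t = z` for `t < 0`, so that
`X_{0-} = z`): on `[T_k, T_{k+1})` it is `γ_{t - T_k}(X_{T_k})`. The index `k` of that interval
is the first one with `t < T_{k+1}`; the value at a time beyond all the jump times is irrelevant. -/
def process {N : ℕ} (b : Conf N → Conf N) (a : Fin N → Conf N → Conf N)
    (f : Fin N → Conf N → ℝ) (z : Conf N) (t : ℝ) (ζ : Noise) : Conf N :=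
  if t < 0 then z
  else
    let k := sInf {k : ℕ | t < jumpTime b a f z (k + 1) ζ}
    flow b (t - jumpTime b a f z k ζ) (jumpRecord b a f z ζ k).2

/-- The jump chain `Z_k = X_{T_k-}`, started from `Z_0 = z`. -/
def jumpChain {N : ℕ} (b : Conf N → Conf N) (a : Fin N → Conf N → Conf N)
    (f : Fin N → Conf N → ℝ) (z : Conf N) (k : ℕ) (ζ : Noise) : Conf N :=
  Function.leftLim (fun t => process b a f z t ζ) (jumpTime b a f z k ζ)

/-- The transition kernel `K` of the jump chain: `K(z, ·)` is the law of `Z_1` when `Z_0 = z`. -/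
def jumpKernel {N : ℕ} (b : Conf N → Conf N) (a : Fin N → Conf N → Conf N)
    (f : Fin N → Conf N → ℝ) (z : Conf N) : Measure (Conf N) :=
  noiseLaw.map (jumpChain b a f z 1)

/-- The `n`-fold iterate of a transition kernel:
`K^0(x, ·) = δ_x` and `K^{n+1}(x, B) = ∫ K^n(y, B) K(x, dy)`. -/
def iterKernel {E : Type*} [MeasurableSpace E] (K : E → Measure E) : ℕ → E → Measure E
  | 0, x => Measure.dirac x
  | n + 1, x => (K x).bind (iterKernel K n)

/-! ### Skeletons and the derivation matrix -/

/-- The post-jump configurations `x_0, …, x_n` of the skeleton,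
`x_{k+1} = Δ_{i_{k+1}}(γ_{t_{k+1}}(x_k))`. The times `t_1, …, t_{n+1}` are `t 0, …, t n`. -/
def skeletonConf {N n : ℕ} (b : Conf N → Conf N) (a : Fin N → Conf N → Conf N)
    (x₀ : Conf N) (t : Fin (n + 1) → ℝ) (i : Fin (n + 1) → Fin N) : Fin (n + 1) → Conf N :=
  Fin.induction (motive := fun _ => Conf N) x₀
    (fun k x => afterJump a (i k.succ) (flow b (t k.castSucc) x))

/-- The endpoint `η_{x_0,t,i}(s_{n+1}) = γ_{t_{n+1}}(x_n)` of the skeleton. -/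
def skeletonEnd {N n : ℕ} (b : Conf N → Conf N) (a : Fin N → Conf N → Conf N)
    (x₀ : Conf N) (t : Fin (n + 1) → ℝ) (i : Fin (n + 1) → Fin N) : Conf N :=
  flow b (t (Fin.last n)) (skeletonConf b a x₀ t i (Fin.last n))

/-- The `N × (n+1)` derivation matrix `σ(x_0,t,i) = (∂_{t_j} η^k_{x_0,t,i}(s_{n+1}))_{k,j}`, the
partial derivatives being taken within `t_j ≥ 0` (so they are right derivatives at `t_j = 0`). -/
def derivationMatrix {N n : ℕ} (b : Conf N → Conf N) (a : Fin N → Conf N → Conf N)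
    (x₀ : Conf N) (t : Fin (n + 1) → ℝ) (i : Fin (n + 1) → Fin N) :
    Matrix (Fin N) (Fin (n + 1)) ℝ :=
  Matrix.of fun k j =>
    derivWithin (fun r : ℝ => skeletonEnd b a x₀ (Function.update t j r) i k) (Ici 0) (t j)

end

end JumpPDMP

/-!
The jump chain follows, with positive probability, any prescribed sequence `i 0, …, i n` of jumping
particles. Along such a path it ends at `chainEnd b a (n + 1) i t x`, a function of the starting
point `x` and of the waiting times `t`; the waiting times have a positive continuous joint density,
so that for `x` near `z₀` the law `K^{n+1}(x, ·)` dominates a multiple of the image of Lebesgue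
measure on a small box `(0, ε)^{n+1}` under `t ↦ chainEnd b a (n + 1) i t x`
(`exists_mul_volume_chainEnd_le_iterKernel`). The derivative of this map in `t` at
`(t, x) = (0, z₀)` is the derivation matrix `σ` at `x₀ = Δ_{i 0}(z₀)`, and `det (σ σᵀ) > 0` makes it
surjective. A submersion maps Lebesgue measure to a measure with a density bounded below on a ball,
uniformly for `x` near `z₀`
(`exists_mul_measure_le_measure_preimage_of_hasStrictFDerivAt`); a smooth bump function supported in
that ball gives the density `ν`.

The flow need not be differentiated at positive times. At time `0` it is strictly differentiable
jointly in time and space (`hasStrictFDerivAt_flow`), which follows from Grönwall's inequality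
alone, hence so is the path map at `(0, z₀)`. A strict derivative is exactly a linear approximation,
with small Lipschitz error, uniform on a neighbourhood of `(0, z₀)`. That neighbourhood contains
points with all waiting times positive, and the submersion argument is carried out near one of them.

The iterates of the kernel are meaningful because the jump kernel is measurable in its starting
point. This rests on the identity `Z₁ = chainStep b a f z (v, ξ)`, which holds almost surely
(`jumpChain_one`), and on the joint measurability of the waiting time, whose sublevel sets are
described by `waitingTime_le_iff`.
-/

namespace JumpPDMP

open Filter Metric
open scoped Topology Manifold

/-! ### The flow of a Lipschitz drift -/

section Flow

/-- For a Lipschitz vector field, Picard-Lindelöf yields local solutions on a time interval that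
does not depend on the starting point: on a ball of radius `1 + ‖v x‖` around `x` the field is at
most `(1 + K) (1 + ‖v x‖)`. -/
lemma exists_local_integralCurve {E : Type*} [NormedAddCommGroup E] [NormedSpace ℝ E]
    [CompleteSpace E] {v : E → E} {K : ℝ≥0} (hK : LipschitzWith K v) (x : E) :
    ∃ u : ℝ → E, u 0 = x ∧
      ∀ t ∈ Ioo (-(1 / (1 + (K : ℝ)))) (1 / (1 + (K : ℝ))), HasDerivAt u (v (u t)) t := by
  set ε : ℝ := 1 / (1 + (K : ℝ)) with hε
  have hε0 : 0 < ε := by positivity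
  have h0 : (0 : ℝ) ∈ Icc (-ε) ε := ⟨by linarith, hε0.le⟩
  have hpl : IsPicardLindelof (fun _ => v) (tmin := -ε) (tmax := ε) ⟨0, h0⟩ x
      (1 + ‖v x‖₊) 0 ((1 + K) * (1 + ‖v x‖₊)) K := by
    refine IsPicardLindelof.of_time_independent (fun y hy => ?_) hK.lipschitzOnWith ?_
    · have h1 : ‖v y‖ ≤ ‖v x‖ + K * dist y x := by
        have := hK.dist_le_mul y x
        rw [dist_eq_norm] at this
        calc ‖v y‖ = ‖v x + (v y - v x)‖ := by simp
          _ ≤ ‖v x‖ + ‖v y - v x‖ := norm_add_le _ _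
          _ ≤ _ := by linarith
      have h2 : dist y x ≤ 1 + ‖v x‖ := by simpa using hy
      have h3 : (K : ℝ) * dist y x ≤ K * (1 + ‖v x‖) := by gcongr
      push_cast
      nlinarith [norm_nonneg (v x)]
    · push_cast
      simp only [sub_zero, zero_sub, neg_neg, max_self]
      rw [hε]
      field_simp
      exact le_rfl
  obtain ⟨u, hu0, hu⟩ := hpl.exists_eq_forall_mem_Icc_hasDerivWithinAt₀
  exact ⟨u, hu0, fun t ht => (hu t (Ioo_subset_Icc_self ht)).hasDerivAt (Icc_mem_nhds ht.1 ht.2)⟩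

lemma exists_global_integralCurve {E : Type*} [NormedAddCommGroup E] [NormedSpace ℝ E]
    [CompleteSpace E] {v : E → E} {K : ℝ≥0} (hv : ContDiff ℝ 1 v) (hK : LipschitzWith K v) (x : E) :
    ∃ u : ℝ → E, u 0 = x ∧ ∀ t, HasDerivAt u (v (u t)) t := by
  have hsec : CMDiff 1 (fun y : E => (⟨y, v y⟩ : TangentBundle 𝓘(ℝ, E) E)) :=
    contMDiff_vectorSpace_iff_contDiff.2 hv
  obtain ⟨u, hu0, hu⟩ := exists_isMIntegralCurve_of_isMIntegralCurveOn (I := 𝓘(ℝ, E)) hsec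
    (ε := 1 / (1 + (K : ℝ))) (by positivity) (fun y => by
      obtain ⟨u, hu0, hu⟩ := exists_local_integralCurve hK y
      exact ⟨u, hu0, fun t ht => (hu t ht).hasFDerivAt.hasMFDerivAt.hasMFDerivWithinAt⟩) x
  refine ⟨u, hu0, fun t => ?_⟩
  have h : HasFDerivAt u ((1 : ℝ →L[ℝ] ℝ).smulRight (v (u t))) t := (hu t).hasFDerivAt
  simpa using h.hasDerivAt

variable {N : ℕ} {b : Conf N → Conf N} {K : ℝ≥0}

lemma isTrajectory_flow (hb : ContDiff ℝ 1 b) (hK : LipschitzWith K b) (x : Conf N) :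
    IsTrajectory b x (fun t => flow b t x) :=
  Classical.epsilon_spec (exists_global_integralCurve hb hK x)

lemma flow_zero (hb : ContDiff ℝ 1 b) (hK : LipschitzWith K b) (x : Conf N) : flow b 0 x = x :=
  (isTrajectory_flow hb hK x).1

lemma hasDerivAt_flow (hb : ContDiff ℝ 1 b) (hK : LipschitzWith K b) (x : Conf N) (t : ℝ) :
    HasDerivAt (fun s => flow b s x) (b (flow b t x)) t :=
  (isTrajectory_flow hb hK x).2 t

lemma IsTrajectory.dist_le (hK : LipschitzWith K b) {x y : Conf N} {u w : ℝ → Conf N}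
    (hu : IsTrajectory b x u) (hw : IsTrajectory b y w) (t : ℝ) :
    dist (u t) (w t) ≤ dist x y * Real.exp (K * |t|) := by
  rcases le_total 0 t with ht | ht
  · have := dist_le_of_trajectories_ODE (v := fun _ => b) (f := u) (g := w) (a := 0) (b := t)
      (fun _ => hK) (fun s _ => (hu.2 s).continuousAt.continuousWithinAt)
      (fun s _ => (hu.2 s).hasDerivWithinAt) (fun s _ => (hw.2 s).continuousAt.continuousWithinAt)
      (fun s _ => (hw.2 s).hasDerivWithinAt) (δ := dist x y) (by rw [hu.1, hw.1]) t ⟨ht, le_rfl⟩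
    simpa [abs_of_nonneg ht] using this
  · -- Backward in time, use the reversed trajectories, which solve the equation with drift `-b`.
    have key : ∀ {z : Conf N} {v : ℝ → Conf N}, IsTrajectory b z v → ∀ s,
        HasDerivAt (fun r => v (-r)) ((fun y => -b y) (v (-s))) s := fun {z v} hv s => by
      have h := (hv.2 (-s)).scomp s (hasDerivAt_neg s)
      rw [neg_one_smul] at h
      exact h
    have hKn : LipschitzWith K (fun y => -b y) := hK.neg
    have := dist_le_of_trajectories_ODE (v := fun _ => fun y => -b y) (f := fun r => u (-r))
      (g := fun r => w (-r)) (a := 0) (b := -t)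
      (fun _ => hKn) (fun s _ => (key hu s).continuousAt.continuousWithinAt)
      (fun s _ => (key hu s).hasDerivWithinAt)
      (fun s _ => (key hw s).continuousAt.continuousWithinAt)
      (fun s _ => (key hw s).hasDerivWithinAt) (δ := dist x y) (by simp [hu.1, hw.1])
      (-t) ⟨by linarith, le_rfl⟩
    simpa [abs_of_nonpos ht] using this

lemma dist_flow_le (hb : ContDiff ℝ 1 b) (hK : LipschitzWith K b) (t : ℝ) (x y : Conf N) :
    dist (flow b t x) (flow b t y) ≤ dist x y * Real.exp (K * |t|) :=
  (isTrajectory_flow hb hK x).dist_le hK (isTrajectory_flow hb hK y) t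

lemma continuous_flow (hb : ContDiff ℝ 1 b) (hK : LipschitzWith K b) :
    Continuous (fun p : ℝ × Conf N => flow b p.1 p.2) := by
  rw [continuous_iff_continuousAt]
  rintro ⟨t, x⟩
  have h1 : Tendsto (fun p : ℝ × Conf N => dist p.2 x * Real.exp (K * |p.1|)) (𝓝 (t, x)) (𝓝 0) := by
    have : Continuous fun p : ℝ × Conf N => dist p.2 x * Real.exp (K * |p.1|) := by fun_prop
    simpa using this.tendsto (t, x)
  have h2 : Tendsto (fun p : ℝ × Conf N => dist (flow b p.1 x) (flow b t x)) (𝓝 (t, x)) (𝓝 0) := by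
    have h3 : Tendsto (fun p : ℝ × Conf N => flow b p.1 x) (𝓝 (t, x)) (𝓝 (flow b t x)) :=
      (hasDerivAt_flow hb hK x t).continuousAt.tendsto.comp continuous_fst.continuousAt
    exact tendsto_iff_dist_tendsto_zero.1 h3
  refine tendsto_iff_dist_tendsto_zero.2
    (squeeze_zero (fun _ => dist_nonneg) (fun p => ?_) (by simpa using h1.add h2))
  exact (dist_triangle _ (flow b p.1 x) _).trans
    (add_le_add_left (dist_flow_le hb hK p.1 p.2 x) _)

/-- The flow is strictly differentiable in time and space at time `0`, with derivative
`(t, x) ↦ x + t b(z)`. Only the Lipschitz bound on the drift enters: the increment in space over a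
time `s` differs from `x - y` by at most a multiple of `|s| ‖x - y‖`. -/
lemma hasStrictFDerivAt_flow (hb : ContDiff ℝ 1 b) (hK : LipschitzWith K b) (z : Conf N) :
    HasStrictFDerivAt (fun p : ℝ × Conf N => flow b p.1 p.2)
      (ContinuousLinearMap.snd ℝ ℝ (Conf N) +
        (ContinuousLinearMap.fst ℝ ℝ (Conf N)).smulRight (b z)) (0, z) := by
  refine HasStrictFDerivAt.of_isLittleO (Asymptotics.isLittleO_iff.2 fun c hc => ?_)
  have hcont : Continuous fun p : ℝ × Conf N => b (flow b p.1 p.2) :=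
    hb.continuous.comp (continuous_flow hb hK)
  obtain ⟨r, hr, hball⟩ : ∃ r > 0, ∀ p : ℝ × Conf N, p ∈ ball (0, z) r →
      ‖b (flow b p.1 p.2) - b z‖ ≤ c / 2 := by
    have h := hcont.tendsto (0, z)
    rw [flow_zero hb hK, tendsto_iff_norm_sub_tendsto_zero] at h
    obtain ⟨r, hr, hsub⟩ := Metric.eventually_nhds_iff_ball.1
      (h.eventually (Iic_mem_nhds (half_pos hc)))
    exact ⟨r, hr, hsub⟩
  set M : ℝ := K * Real.exp K with hM
  have hM0 : 0 ≤ M := by positivity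
  set r' : ℝ := min r (min 1 (c / (2 * (M + 1)))) with hr'
  have hr'0 : 0 < r' := by positivity
  have hU : ball ((0 : ℝ), z) r' ×ˢ ball ((0 : ℝ), z) r' ∈ 𝓝 (((0 : ℝ), z), ((0 : ℝ), z)) :=
    prod_mem_nhds (ball_mem_nhds _ hr'0) (ball_mem_nhds _ hr'0)
  filter_upwards [hU]
  rintro ⟨⟨t, x⟩, ⟨s, y⟩⟩ ⟨h1, h2⟩
  rw [mem_ball, Prod.dist_eq, max_lt_iff] at h1 h2
  simp only [dist_zero_right, Real.norm_eq_abs] at h1 h2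
  have hrr : r' ≤ r := min_le_left _ _
  have hr1 : r' ≤ 1 := (min_le_right _ _).trans (min_le_left _ _)
  have hrc : r' ≤ c / (2 * (M + 1)) := (min_le_right _ _).trans (min_le_right _ _)
  have hA : ‖flow b t x - flow b s x - (t - s) • b z‖ ≤ c / 2 * |t - s| := by
    have := (convex_ball (0 : ℝ) r').norm_image_sub_le_of_norm_hasDerivWithin_le
      (f := fun u => flow b u x - u • b z) (f' := fun u => b (flow b u x) - b z) (C := c / 2)
      (x := s) (y := t)
      (fun u _ => ((hasDerivAt_flow hb hK x u).sub
        (by simpa using (hasDerivAt_id u).smul_const (b z))).hasDerivWithinAt)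
      (fun u hu => hball (u, x) (by
        rw [mem_ball, Prod.dist_eq]
        exact max_lt (lt_of_lt_of_le hu hrr) (lt_of_lt_of_le h1.2 hrr)))
      (by simpa using h2.1) (by simpa using h1.1)
    rw [Real.norm_eq_abs] at this
    have e : flow b t x - flow b s x - (t - s) • b z =
        flow b t x - t • b z - (flow b s x - s • b z) := by rw [sub_smul]; abel
    rw [e]
    exact this
  have hB : ‖flow b s x - flow b s y - (x - y)‖ ≤ c / 2 * ‖x - y‖ := by
    have := (convex_ball (0 : ℝ) r').norm_image_sub_le_of_norm_hasDerivWithin_le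
      (f := fun u => flow b u x - flow b u y) (f' := fun u => b (flow b u x) - b (flow b u y))
      (C := M * ‖x - y‖) (x := 0) (y := s)
      (fun u _ => ((hasDerivAt_flow hb hK x u).sub (hasDerivAt_flow hb hK y u)).hasDerivWithinAt)
      (fun u hu => by
        have hu1 : |u| ≤ 1 := (by simpa using hu : |u| < r').le.trans hr1
        have e1 := hK.dist_le_mul (flow b u x) (flow b u y)
        have e2 := dist_flow_le hb hK u x y
        rw [← dist_eq_norm, ← dist_eq_norm]
        refine e1.trans ((mul_le_mul_of_nonneg_left e2 K.2).trans ?_)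
        have e3 : Real.exp (K * |u|) ≤ Real.exp K :=
          Real.exp_le_exp.2 (mul_le_of_le_one_right K.2 hu1)
        rw [hM]
        have : (K : ℝ) * (dist x y * Real.exp (K * |u|)) ≤ K * (dist x y * Real.exp K) := by gcongr
        refine this.trans (le_of_eq (by ring)))
      (by simpa using hr'0) (by simpa using h2.1)
    simp only [flow_zero hb hK, sub_zero, Real.norm_eq_abs] at this
    refine this.trans ?_
    have hs : |s| ≤ c / (2 * (M + 1)) := h2.1.le.trans hrc
    have : M * |s| ≤ c / 2 := by
      calc M * |s| ≤ M * (c / (2 * (M + 1))) := by gcongr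
        _ = (M / (M + 1)) * (c / 2) := by field_simp
        _ ≤ 1 * (c / 2) := by
          gcongr
          rw [div_le_one (by positivity)]; linarith
        _ = c / 2 := one_mul _
    calc M * ‖x - y‖ * |s| = (M * |s|) * ‖x - y‖ := by ring
      _ ≤ c / 2 * ‖x - y‖ := by gcongr
  have hn1 : |t - s| ≤ ‖((t, x) : ℝ × Conf N) - (s, y)‖ := norm_fst_le ((t, x) - (s, y))
  have hn2 : ‖x - y‖ ≤ ‖((t, x) : ℝ × Conf N) - (s, y)‖ := norm_snd_le ((t, x) - (s, y))
  have hsum : flow b t x - flow b s y -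
      (ContinuousLinearMap.snd ℝ ℝ (Conf N) +
        (ContinuousLinearMap.fst ℝ ℝ (Conf N)).smulRight (b z)) ((t, x) - (s, y)) =
      (flow b t x - flow b s x - (t - s) • b z) + (flow b s x - flow b s y - (x - y)) := by
    simp
    abel
  change ‖flow b t x - flow b s y - _‖ ≤ _
  rw [hsum]
  calc _ ≤ c / 2 * |t - s| + c / 2 * ‖x - y‖ := (norm_add_le _ _).trans (add_le_add hA hB)
    _ ≤ c / 2 * ‖((t, x) : ℝ × Conf N) - (s, y)‖ + c / 2 * ‖((t, x) : ℝ × Conf N) - (s, y)‖ := by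
      gcongr
    _ = _ := by ring

end Flow

/-! ### Waiting times -/

section WaitingTime

variable {N : ℕ} {b : Conf N → Conf N} {f : Fin N → Conf N → ℝ}

/-- The jump rate integrated along the trajectory from `x` up to time `t`. -/
noncomputable def cumRate (b : Conf N → Conf N) (f : Fin N → Conf N → ℝ) (x : Conf N) (t : ℝ) : ℝ :=
  ∫ s in (0 : ℝ)..t, totalRate f (flow b s x)

lemma continuous_totalRate (hf : ∀ i, Continuous (f i)) : Continuous (totalRate f) :=
  continuous_finsetSum _ fun i _ => hf i

lemma continuous_rate_along_flow (hF : Continuous fun p : ℝ × Conf N => flow b p.1 p.2)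
    (hf : ∀ i, Continuous (f i)) :
    Continuous fun p : Conf N × ℝ => totalRate f (flow b p.2 p.1) :=
  (continuous_totalRate hf).comp (hF.comp continuous_swap)

lemma continuous_cumRate (hF : Continuous fun p : ℝ × Conf N => flow b p.1 p.2)
    (hf : ∀ i, Continuous (f i)) : Continuous fun p : Conf N × ℝ => cumRate b f p.1 p.2 := by
  refine intervalIntegral.continuous_parametric_intervalIntegral_of_continuous
    (f := fun (p : Conf N × ℝ) s => totalRate f (flow b s p.1)) ?_ continuous_snd
  exact (continuous_rate_along_flow hF hf).comp
    (((continuous_fst.comp continuous_fst).prodMk continuous_snd :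
      Continuous fun q : (Conf N × ℝ) × ℝ => (q.1.1, q.2)))

lemma hasDerivAt_cumRate (hF : Continuous fun p : ℝ × Conf N => flow b p.1 p.2)
    (hf : ∀ i, Continuous (f i)) (x : Conf N) (t : ℝ) :
    HasDerivAt (cumRate b f x) (totalRate f (flow b t x)) t :=
  (((continuous_rate_along_flow hF hf).comp
    (Continuous.prodMk_right x)).integral_hasStrictDerivAt 0 t).hasDerivAt

lemma cumRate_zero (x : Conf N) : cumRate b f x 0 = 0 := intervalIntegral.integral_same

lemma strictMono_cumRate (hF : Continuous fun p : ℝ × Conf N => flow b p.1 p.2)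
    (hf : ∀ i, Continuous (f i)) (hpos : ∀ x, 0 < totalRate f x) (x : Conf N) :
    StrictMono (cumRate b f x) :=
  strictMono_of_hasDerivAt_pos (hasDerivAt_cumRate hF hf x) fun _ => hpos _

/-- The integrated rate reaches every level, so the set whose infimum defines `waitingTime` is
nonempty. -/
lemma exists_le_cumRate (hF : Continuous fun p : ℝ × Conf N => flow b p.1 p.2)
    (hf : ∀ i, Continuous (f i)) (hpos : ∀ x, 0 < totalRate f x) {x : Conf N}
    (hrate : ∫⁻ s in Ioi (0 : ℝ), ENNReal.ofReal (totalRate f (flow b s x)) = ⊤) (ξ : ℝ) :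
    ∃ t, 0 ≤ t ∧ ξ ≤ cumRate b f x t := by
  by_contra! h
  have hc : Continuous fun s => totalRate f (flow b s x) :=
    (continuous_rate_along_flow hF hf).comp (Continuous.prodMk_right x)
  have hint : IntegrableOn (fun s => totalRate f (flow b s x)) (Ioi 0) := by
    refine integrableOn_Ioi_of_intervalIntegral_norm_bounded (l := atTop) (b := id) ξ 0
      (fun t => hc.integrableOn_Ioc) tendsto_id ?_
    filter_upwards [eventually_ge_atTop 0] with t ht
    simp only [Real.norm_eq_abs, abs_of_pos (hpos _)]
    exact (h t ht).le
  have := hint.lintegral_lt_top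
  exact this.ne hrate

lemma waitingTime_le_iff (hF : Continuous fun p : ℝ × Conf N => flow b p.1 p.2)
    (hf : ∀ i, Continuous (f i)) (hpos : ∀ x, 0 < totalRate f x) {x : Conf N}
    (hrate : ∫⁻ s in Ioi (0 : ℝ), ENNReal.ofReal (totalRate f (flow b s x)) = ⊤)
    {ξ t : ℝ} (ht : 0 ≤ t) : waitingTime b f x ξ ≤ t ↔ ξ ≤ cumRate b f x t := by
  have hbdd : BddBelow {t : ℝ | 0 ≤ t ∧ ξ ≤ cumRate b f x t} := ⟨0, fun s hs => hs.1⟩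
  constructor
  · intro h
    have hclosed : IsClosed {t : ℝ | 0 ≤ t ∧ ξ ≤ cumRate b f x t} := by
      have hc : Continuous (cumRate b f x) :=
        (continuous_cumRate hF hf).comp (Continuous.prodMk_right x)
      exact (isClosed_le continuous_const continuous_id).inter (isClosed_le continuous_const hc)
    have hmem := hclosed.csInf_mem (exists_le_cumRate hF hf hpos hrate ξ) hbdd
    exact hmem.2.trans ((strictMono_cumRate hF hf hpos x).monotone h)
  · intro h
    exact csInf_le hbdd ⟨ht, h⟩

lemma waitingTime_nonneg (x : Conf N) (ξ : ℝ) : 0 ≤ waitingTime b f x ξ :=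
  Real.sInf_nonneg fun _ ht => ht.1

lemma waitingTime_pos (hF : Continuous fun p : ℝ × Conf N => flow b p.1 p.2)
    (hf : ∀ i, Continuous (f i)) (hpos : ∀ x, 0 < totalRate f x) {x : Conf N}
    (hrate : ∫⁻ s in Ioi (0 : ℝ), ENNReal.ofReal (totalRate f (flow b s x)) = ⊤)
    {ξ : ℝ} (hξ : 0 < ξ) : 0 < waitingTime b f x ξ := by
  by_contra! h
  rw [waitingTime_le_iff hF hf hpos hrate le_rfl, cumRate_zero] at h
  exact h.not_gt hξ

lemma waitingTime_cumRate (hF : Continuous fun p : ℝ × Conf N => flow b p.1 p.2)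
    (hf : ∀ i, Continuous (f i)) (hpos : ∀ x, 0 < totalRate f x) {x : Conf N}
    (hrate : ∫⁻ s in Ioi (0 : ℝ), ENNReal.ofReal (totalRate f (flow b s x)) = ⊤)
    {t : ℝ} (ht : 0 ≤ t) : waitingTime b f x (cumRate b f x t) = t := by
  refine le_antisymm ((waitingTime_le_iff hF hf hpos hrate ht).2 le_rfl) ?_
  have h := (waitingTime_le_iff hF hf hpos hrate
    (waitingTime_nonneg x (cumRate b f x t))).1 le_rfl
  exact (strictMono_cumRate hF hf hpos x).le_iff_le.1 h

lemma measurable_waitingTime (hF : Continuous fun p : ℝ × Conf N => flow b p.1 p.2)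
    (hf : ∀ i, Continuous (f i)) (hpos : ∀ x, 0 < totalRate f x)
    (hrate : ∀ x, ∫⁻ s in Ioi (0 : ℝ), ENNReal.ofReal (totalRate f (flow b s x)) = ⊤) :
    Measurable fun p : Conf N × ℝ => waitingTime b f p.1 p.2 := by
  refine measurable_of_Iic fun t => ?_
  rcases lt_or_ge t 0 with ht | ht
  · convert MeasurableSet.empty
    ext p
    simpa using ht.trans_le (waitingTime_nonneg p.1 p.2)
  · have : (fun p : Conf N × ℝ => waitingTime b f p.1 p.2) ⁻¹' Iic t =
        {p | p.2 ≤ cumRate b f p.1 t} := by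
      ext p
      exact waitingTime_le_iff hF hf hpos (hrate p.1) ht
    rw [this]
    have hc : Continuous fun p : Conf N × ℝ => cumRate b f p.1 t :=
      (continuous_cumRate hF hf).comp (continuous_fst.prodMk continuous_const)
    exact measurableSet_le measurable_snd hc.measurable

/-- The waiting time has density `t ↦ totalRate f (γ_t x) exp (-∫_0^t totalRate f (γ_s x) ds)`;
only the lower bound is recorded, for the sets `S` of times whose levels `ξ` form `cumRate '' S`. -/
lemma lintegral_le_expMeasure_image_cumRate
    (hF : Continuous fun p : ℝ × Conf N => flow b p.1 p.2)
    (hf : ∀ i, Continuous (f i)) (hpos : ∀ x, 0 < totalRate f x) (x : Conf N)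
    {S : Set ℝ} (hS : MeasurableSet S) (hS0 : S ⊆ Ici 0) :
    ∫⁻ t in S, ENNReal.ofReal (totalRate f (flow b t x) * Real.exp (-cumRate b f x t)) ≤
      expMeasure 1 (cumRate b f x '' S) := by
  refine le_trans (le_of_eq ?_) (withDensity_apply_le (exponentialPDF 1) (cumRate b f x '' S))
  rw [lintegral_image_eq_lintegral_abs_deriv_mul hS
    (fun t _ => (hasDerivAt_cumRate hF hf x t).hasDerivWithinAt)
    (strictMono_cumRate hF hf hpos x).injective.injOn]
  refine setLIntegral_congr_fun hS fun t ht => ?_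
  have h0 : 0 ≤ cumRate b f x t := by
    rw [← cumRate_zero (b := b) (f := f) x]
    exact (strictMono_cumRate hF hf hpos x).monotone (hS0 ht)
  rw [exponentialPDF_of_nonneg h0, abs_of_pos (hpos _), ENNReal.ofReal_mul (hpos _).le]
  simp

end WaitingTime

/-! ### The jump kernel -/

section JumpKernel

variable {N : ℕ} {b : Conf N → Conf N} {a : Fin N → Conf N → Conf N} {f : Fin N → Conf N → ℝ}

lemma jumpFrom_eq_afterJump (hpos : ∀ i x, 0 ≤ f i x) (y : Conf N) (i : Fin N) {v : ℝ}
    (hv : v * totalRate f y ∈ Ioc (∑ j ∈ Finset.Iio i, f j y) (∑ j ∈ Finset.Iic i, f j y)) :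
    jumpFrom a f y v = afterJump a i y := by
  unfold jumpFrom afterJump
  congr 1
  rw [Finset.sum_eq_single i]
  · exact Set.indicator_of_mem hv _
  · intro k _ hki
    refine Set.indicator_of_notMem (fun hk => ?_) _
    have hmono : ∀ {p q : Fin N}, p < q → ∑ j ∈ Finset.Iic p, f j y ≤ ∑ j ∈ Finset.Iio q, f j y :=
      fun hpq => Finset.sum_le_sum_of_subset_of_nonneg
        (fun j hj => Finset.mem_Iio.2 ((Finset.mem_Iic.1 hj).trans_lt hpq)) fun j _ _ => hpos j y
    rcases lt_or_gt_of_ne hki with h | h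
    · exact (hk.2.trans (hmono h)).not_gt hv.1
    · exact (hv.2.trans (hmono h)).not_gt hk.1
  · simp

/-- The uniform variable selects particle `i` with probability `f i y / totalRate f y`. -/
lemma volume_jumpFrom_eq_afterJump (hpos : ∀ i x, 0 < f i x) (y : Conf N) (i : Fin N) :
    ENNReal.ofReal (f i y / totalRate f y) ≤
      volume {v : unitInterval | jumpFrom a f y v = afterJump a i y} := by
  have hT : 0 < totalRate f y := Finset.sum_pos (fun j _ => hpos j y) ⟨i, Finset.mem_univ i⟩
  set A := ∑ j ∈ Finset.Iio i, f j y with hA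
  set B := ∑ j ∈ Finset.Iic i, f j y with hB
  have hAB : B = f i y + A := by
    rw [hA, hB, ← Finset.Iio_insert, Finset.sum_insert (by simp)]
  have hA0 : 0 ≤ A := Finset.sum_nonneg fun j _ => (hpos j y).le
  have hBT : B ≤ totalRate f y :=
    Finset.sum_le_sum_of_subset_of_nonneg (Finset.subset_univ _) fun j _ _ => (hpos j y).le
  have hfi := hpos i y
  have hp : A / totalRate f y ∈ unitInterval :=
    ⟨by positivity, by rw [div_le_one hT]; linarith⟩
  have hq : B / totalRate f y ∈ unitInterval :=
    ⟨div_nonneg (by linarith) hT.le, by rwa [div_le_one hT]⟩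
  have hsub : Ioc (⟨_, hp⟩ : unitInterval) ⟨_, hq⟩ ⊆
      {v : unitInterval | jumpFrom a f y v = afterJump a i y} := by
    intro v hv
    refine jumpFrom_eq_afterJump (fun i x => (hpos i x).le) y i ⟨?_, ?_⟩
    · exact (div_lt_iff₀ hT).1 (show A / totalRate f y < (v : ℝ) from hv.1)
    · exact (le_div_iff₀ hT).1 (show (v : ℝ) ≤ B / totalRate f y from hv.2)
  refine le_trans (le_of_eq ?_) (measure_mono hsub)
  rw [unitInterval.volume_Ioc]
  congr 1
  simp only
  rw [hAB]
  ring

lemma measurable_jumpFrom (ha : ∀ i, Continuous (a i)) (hf : ∀ i, Continuous (f i)) :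
    Measurable fun p : Conf N × ℝ => jumpFrom a f p.1 p.2 := by
  unfold jumpFrom
  refine measurable_fst.add (Finset.measurable_fun_sum _ fun i _ => ?_)
  have h1 : Measurable fun p : Conf N × ℝ => ∑ j ∈ Finset.Iio i, f j p.1 :=
    Finset.measurable_fun_sum _ fun j _ => (hf j).measurable.comp measurable_fst
  have h2 : Measurable fun p : Conf N × ℝ => ∑ j ∈ Finset.Iic i, f j p.1 :=
    Finset.measurable_fun_sum _ fun j _ => (hf j).measurable.comp measurable_fst
  have h3 : Measurable fun p : Conf N × ℝ => p.2 * totalRate f p.1 :=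
    measurable_snd.mul ((continuous_totalRate hf).measurable.comp measurable_fst)
  exact Measurable.ite ((measurableSet_lt h1 h3).inter (measurableSet_le h3 h2))
    ((ha i).measurable.comp measurable_fst) measurable_const

/-- The first step of the jump chain as a function of the starting point and of the two variables
that drive it: the uniform variable choosing the particle that jumps at time `0`, and the level
that determines the waiting time. -/
noncomputable def chainStep (b : Conf N → Conf N) (a : Fin N → Conf N → Conf N)
    (f : Fin N → Conf N → ℝ) (z : Conf N) (p : unitInterval × ℝ) : Conf N :=
  flow b (waitingTime b f (jumpFrom a f z p.1) p.2) (jumpFrom a f z p.1)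

/-- Before the first jump time `T > 0` the process is `t ↦ γ_t(r)`, with `r` the configuration after
the jump at time `0`, so its left limit at `T` is `γ_T(r)`. For a level `ξ ≤ 0` the waiting time
vanishes and the left limit is the starting point instead. -/
lemma jumpChain_one (hF : Continuous fun p : ℝ × Conf N => flow b p.1 p.2)
    (hf : ∀ i, Continuous (f i)) (hpos : ∀ x, 0 < totalRate f x)
    (hrate : ∀ x, ∫⁻ s in Ioi (0 : ℝ), ENNReal.ofReal (totalRate f (flow b s x)) = ⊤)
    (z : Conf N) {ζ : Noise} (hζ : 0 < (ζ 1).1) :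
    jumpChain b a f z 1 ζ = chainStep b a f z ((ζ 0).2, (ζ 1).1) := by
  set r := jumpFrom a f z (ζ 0).2 with hr
  set T := waitingTime b f r (ζ 1).1 with hT
  have hT0 : 0 < T := waitingTime_pos hF hf hpos (hrate r) hζ
  have h1 : jumpTime b a f z 1 ζ = T := by
    simp [jumpTime, jumpRecord, hT, hr]
  have h0 : jumpTime b a f z 0 ζ = 0 := rfl
  unfold jumpChain
  rw [h1]
  refine leftLim_eq_of_tendsto ?_
  have hcont : Tendsto (fun t => flow b t r) (𝓝[<] T) (𝓝 (flow b T r)) :=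
    ((hF.comp (Continuous.prodMk_left r)).tendsto T).mono_left nhdsWithin_le_nhds
  refine hcont.congr' ?_
  filter_upwards [Ioo_mem_nhdsLT hT0] with t ht
  have hk : sInf {k : ℕ | t < jumpTime b a f z (k + 1) ζ} = 0 :=
    Nat.sInf_eq_zero.2 (Or.inl (by simpa [h1] using ht.2))
  simp only [process, if_neg ht.1.not_gt, hk, h0, sub_zero]
  rfl

lemma measurable_chainStep (hF : Continuous fun p : ℝ × Conf N => flow b p.1 p.2)
    (ha : ∀ i, Continuous (a i)) (hf : ∀ i, Continuous (f i)) (hpos : ∀ x, 0 < totalRate f x)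
    (hrate : ∀ x, ∫⁻ s in Ioi (0 : ℝ), ENNReal.ofReal (totalRate f (flow b s x)) = ⊤) :
    Measurable fun q : Conf N × (unitInterval × ℝ) => chainStep b a f q.1 q.2 := by
  have h1 : Measurable fun q : Conf N × (unitInterval × ℝ) => jumpFrom a f q.1 q.2.1 :=
    (measurable_jumpFrom ha hf).comp (measurable_fst.prodMk
      (measurable_subtype_coe.comp (measurable_fst.comp measurable_snd)))
  have h2 := (measurable_waitingTime hF hf hpos hrate).comp
    (h1.prodMk (measurable_snd.comp measurable_snd))
  exact hF.measurable.comp (h2.prodMk h1)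

instance : IsProbabilityMeasure (expMeasure 1) := isProbabilityMeasure_expMeasure one_pos

lemma expMeasure_Iic_zero : expMeasure 1 (Iic 0) = 0 := by
  change (volume.withDensity (exponentialPDF 1)) (Iic 0) = 0
  rw [withDensity_apply _ measurableSet_Iic, setLIntegral_congr Iio_ae_eq_Iic.symm]
  exact lintegral_exponentialPDF_of_nonpos le_rfl

lemma map_noiseLaw :
    noiseLaw.map (fun ζ : Noise => ((ζ 0).2, (ζ 1).1)) =
      (volume : Measure unitInterval).prod (expMeasure 1) := by
  have h := Measure.infinitePi_map_eval_prod
    (P := fun _ : ℕ => (expMeasure 1).prod (volume : Measure unitInterval)) zero_ne_one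
  have hm : Measurable fun ζ : Noise => (ζ 0, ζ 1) :=
    (measurable_pi_apply 0).prodMk (measurable_pi_apply 1)
  have : (fun ζ : Noise => ((ζ 0).2, (ζ 1).1)) = Prod.map Prod.snd Prod.fst ∘ fun ζ => (ζ 0, ζ 1) :=
    rfl
  rw [this, ← Measure.map_map (measurable_snd.prodMap measurable_fst) hm]
  unfold noiseLaw
  rw [h, ← Measure.map_prod_map _ _ measurable_snd measurable_fst,
    Measure.map_snd_prod, Measure.map_fst_prod]
  simp

lemma jumpKernel_eq_map (hF : Continuous fun p : ℝ × Conf N => flow b p.1 p.2)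
    (ha : ∀ i, Continuous (a i)) (hf : ∀ i, Continuous (f i)) (hpos : ∀ x, 0 < totalRate f x)
    (hrate : ∀ x, ∫⁻ s in Ioi (0 : ℝ), ENNReal.ofReal (totalRate f (flow b s x)) = ⊤)
    (z : Conf N) :
    jumpKernel b a f z =
      ((volume : Measure unitInterval).prod (expMeasure 1)).map (chainStep b a f z) := by
  have hm : Measurable fun ζ : Noise => ((ζ 0).2, (ζ 1).1) :=
    (measurable_snd.comp (measurable_pi_apply 0)).prodMk
      (measurable_fst.comp (measurable_pi_apply 1))
  have hstep : Measurable (chainStep b a f z) :=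
    (measurable_chainStep hF ha hf hpos hrate).comp measurable_prodMk_left
  rw [← map_noiseLaw, Measure.map_map hstep hm]
  refine Measure.map_congr ?_
  have hpos1 : ∀ᵐ ζ ∂noiseLaw, 0 < (ζ 1).1 := by
    have h : ∀ᵐ p ∂((volume : Measure unitInterval).prod (expMeasure 1)), 0 < p.2 := by
      have : ∀ᵐ ξ ∂(expMeasure 1), 0 < ξ := by
        rw [ae_iff]
        simp only [not_lt]
        exact expMeasure_Iic_zero
      exact Measure.quasiMeasurePreserving_snd.ae this
    rw [← map_noiseLaw] at h
    exact ae_of_ae_map hm.aemeasurable h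
  filter_upwards [hpos1] with ζ hζ using jumpChain_one hF hf hpos hrate z hζ

lemma measurable_jumpKernel (hF : Continuous fun p : ℝ × Conf N => flow b p.1 p.2)
    (ha : ∀ i, Continuous (a i)) (hf : ∀ i, Continuous (f i)) (hpos : ∀ x, 0 < totalRate f x)
    (hrate : ∀ x, ∫⁻ s in Ioi (0 : ℝ), ENNReal.ofReal (totalRate f (flow b s x)) = ⊤) :
    Measurable (jumpKernel b a f) := by
  have hm := measurable_chainStep hF ha hf hpos hrate
  refine Measure.measurable_of_measurable_coe _ fun s hs => ?_
  have : (fun z => jumpKernel b a f z s) = fun z =>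
      ((volume : Measure unitInterval).prod (expMeasure 1)) (Prod.mk z ⁻¹'
        ((fun q : Conf N × (unitInterval × ℝ) => chainStep b a f q.1 q.2) ⁻¹' s)) := by
    funext z
    rw [jumpKernel_eq_map hF ha hf hpos hrate,
      Measure.map_apply (f := chainStep b a f z) (hm.comp measurable_prodMk_left) hs]
    rfl
  rw [this]
  exact measurable_measure_prodMk_left (hm hs)

lemma measurable_iterKernel {E : Type*} [MeasurableSpace E] {K : E → Measure E}
    (hK : Measurable K) (n : ℕ) : Measurable (iterKernel K n) := by
  induction n with
  | zero => exact Measure.measurable_dirac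
  | succ n ih => exact (Measure.measurable_bind' ih).comp hK

/-- Near `z₀`, a jump of particle `i` followed by a short waiting time contributes to the jump
kernel at least a multiple of Lebesgue measure in that waiting time. -/
lemma exists_smul_map_flow_le_jumpKernel
    (hF : Continuous fun p : ℝ × Conf N => flow b p.1 p.2)
    (ha : ∀ i, Continuous (a i)) (hf : ∀ i, Continuous (f i)) (hfpos : ∀ i x, 0 < f i x)
    (hrate : ∀ x, ∫⁻ s in Ioi (0 : ℝ), ENNReal.ofReal (totalRate f (flow b s x)) = ⊤)
    (z₀ : Conf N) (i : Fin N) :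
    ∃ c > (0 : ℝ), ∀ᶠ ε in 𝓝[>] (0 : ℝ), ∀ᶠ z in 𝓝 z₀,
      ENNReal.ofReal c • (volume.restrict (Ioo 0 ε)).map (fun t => flow b t (afterJump a i z)) ≤
        jumpKernel b a f z := by
  have hpos : ∀ x, 0 < totalRate f x := fun x =>
    Finset.sum_pos (fun j _ => hfpos j x) ⟨i, Finset.mem_univ i⟩
  have hΔ : Continuous (afterJump a i) := continuous_id.add (ha i)
  -- The joint density of the choice of particle `i` and of the waiting time.
  set q : Conf N × ℝ → ℝ := fun p => f i p.1 / totalRate f p.1 *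
    (totalRate f (flow b p.2 (afterJump a i p.1)) * Real.exp (-cumRate b f (afterJump a i p.1) p.2))
    with hq
  have hqc : Continuous q := by
    refine (((hf i).comp continuous_fst).div ((continuous_totalRate hf).comp continuous_fst)
      fun p => (hpos _).ne').mul (Continuous.mul ?_ ?_)
    · exact (continuous_totalRate hf).comp
        (hF.comp (continuous_snd.prodMk (hΔ.comp continuous_fst)))
    · exact Real.continuous_exp.comp ((continuous_cumRate hF hf).comp
        ((hΔ.comp continuous_fst).prodMk continuous_snd)).neg
  have hq0 : 0 < q (z₀, 0) :=
    mul_pos (div_pos (hfpos _ _) (hpos _)) (mul_pos (hpos _) (Real.exp_pos _))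
  refine ⟨q (z₀, 0) / 2, half_pos hq0, ?_⟩
  obtain ⟨r, hr, hball⟩ := Metric.eventually_nhds_iff_ball.1
    ((hqc.tendsto (z₀, 0)).eventually (Ioi_mem_nhds (half_lt_self hq0)))
  filter_upwards [Ioo_mem_nhdsGT hr] with ε hε
  filter_upwards [ball_mem_nhds z₀ hr] with z hz
  have hflow : Measurable fun t => flow b t (afterJump a i z) :=
    (hF.comp (Continuous.prodMk_left _)).measurable
  refine Measure.le_iff.2 fun B hB => ?_
  set S : Set ℝ := (fun t => flow b t (afterJump a i z)) ⁻¹' B ∩ Ioo 0 ε with hSdef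
  have hS : MeasurableSet S := (hflow hB).inter measurableSet_Ioo
  have hS0 : S ⊆ Ici 0 := fun t ht => ht.2.1.le
  have hstep : Measurable (chainStep b a f z) :=
    (measurable_chainStep hF ha hf hpos hrate).comp measurable_prodMk_left
  have hsub : {v : unitInterval | jumpFrom a f z v = afterJump a i z} ×ˢ
      (cumRate b f (afterJump a i z) '' S) ⊆ chainStep b a f z ⁻¹' B := by
    rintro ⟨v, _⟩ ⟨hv, t, ht, rfl⟩
    simp only [mem_ofPred_eq] at hv
    simp only [mem_preimage, chainStep, hv]
    rw [waitingTime_cumRate hF hf hpos (hrate _) (hS0 ht)]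
    exact ht.1
  calc (ENNReal.ofReal (q (z₀, 0) / 2) •
        (volume.restrict (Ioo 0 ε)).map (fun t => flow b t (afterJump a i z))) B
      = ENNReal.ofReal (q (z₀, 0) / 2) * volume S := by
        rw [Measure.smul_apply, smul_eq_mul, Measure.map_apply hflow hB,
          Measure.restrict_apply (hflow hB)]
    _ = ∫⁻ _ in S, ENNReal.ofReal (q (z₀, 0) / 2) := by rw [setLIntegral_const]
    _ ≤ ∫⁻ t in S, ENNReal.ofReal (f i z / totalRate f z) *
          ENNReal.ofReal (totalRate f (flow b t (afterJump a i z)) *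
            Real.exp (-cumRate b f (afterJump a i z) t)) := by
        refine setLIntegral_mono' hS fun t ht => ?_
        rw [← ENNReal.ofReal_mul (div_pos (hfpos _ _) (hpos _)).le]
        refine ENNReal.ofReal_le_ofReal (le_of_lt (hball (z, t) ?_))
        rw [mem_ball, Prod.dist_eq]
        refine max_lt hz ?_
        simpa [abs_of_pos ht.2.1] using ht.2.2.trans hε.2
    _ = ENNReal.ofReal (f i z / totalRate f z) *
          ∫⁻ t in S, ENNReal.ofReal (totalRate f (flow b t (afterJump a i z)) *
            Real.exp (-cumRate b f (afterJump a i z) t)) :=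
        lintegral_const_mul' _ _ ENNReal.ofReal_ne_top
    _ ≤ volume {v : unitInterval | jumpFrom a f z v = afterJump a i z} *
          expMeasure 1 (cumRate b f (afterJump a i z) '' S) :=
        mul_le_mul' (volume_jumpFrom_eq_afterJump hfpos z i)
          (lintegral_le_expMeasure_image_cumRate hF hf hpos _ hS hS0)
    _ = ((volume : Measure unitInterval).prod (expMeasure 1))
          ({v : unitInterval | jumpFrom a f z v = afterJump a i z} ×ˢ
            (cumRate b f (afterJump a i z) '' S)) := (Measure.prod_prod _ _).symm
    _ ≤ ((volume : Measure unitInterval).prod (expMeasure 1)) (chainStep b a f z ⁻¹' B) :=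
        measure_mono hsub
    _ = jumpKernel b a f z B := by
        rw [jumpKernel_eq_map hF ha hf hpos hrate, Measure.map_apply hstep hB]

end JumpKernel

/-! ### Images of Lebesgue measure under submersions -/

section Submersion

variable {E F X : Type*} [NormedAddCommGroup E] [NormedSpace ℝ E] [FiniteDimensional ℝ E]
  [MeasurableSpace E] [BorelSpace E] [NormedAddCommGroup F] [NormedSpace ℝ F]
  [FiniteDimensional ℝ F] [MeasurableSpace F] [BorelSpace F]
  [NormedAddCommGroup X] [NormedSpace ℝ X]

/-- A linear surjection maps Lebesgue measure on a ball to a measure whose density is bounded below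
near the image of the centre. With `R` a right inverse of `A`, the set `{s | A s + y ∈ B}` is a
translate by `R y` of `{s | A s ∈ B}`; integrating over small `y` and exchanging the integrals turns
the measure of the former sets into that of `B`. -/
lemma exists_mul_measure_le_measure_preimage_linear (μ : Measure E) [μ.IsAddHaarMeasure]
    (ν : Measure F) [ν.IsAddHaarMeasure] (A : E →L[ℝ] F) (R : F →L[ℝ] E)
    (hAR : ∀ y, A (R y) = y) (s₀ : E) {ρ : ℝ} (hρ : 0 < ρ) :
    ∃ c : ℝ≥0∞, c ≠ 0 ∧ ∃ δ > (0 : ℝ), ∀ B ⊆ ball (A s₀) δ, MeasurableSet B →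
      c * ν B ≤ μ (ball s₀ ρ ∩ A ⁻¹' B) := by
  -- Translations `y` range over the ball of radius `τ`, points `s` over the one of radius `ρ₁`:
  -- then `s + R y` stays in `ball s₀ ρ`, and `b - A s` is an admissible `y` for `b` near `A s₀`.
  set τ : ℝ := ρ / (2 * (‖R‖ + 1)) with hτ
  have hτ0 : 0 < τ := by positivity
  set ρ₁ : ℝ := min (ρ / 2) (τ / (2 * (‖A‖ + 1))) with hρ₁
  have hρ₁0 : 0 < ρ₁ := by positivity
  have hRτ : ‖R‖ * τ ≤ ρ / 2 := by
    rw [hτ]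
    calc ‖R‖ * (ρ / (2 * (‖R‖ + 1))) = (‖R‖ / (‖R‖ + 1)) * (ρ / 2) := by field_simp
      _ ≤ 1 * (ρ / 2) := by
        gcongr
        rw [div_le_one (by positivity)]; linarith
      _ = ρ / 2 := one_mul _
  have hAρ : ‖A‖ * ρ₁ ≤ τ / 2 := by
    calc ‖A‖ * ρ₁ ≤ ‖A‖ * (τ / (2 * (‖A‖ + 1))) := by gcongr; exact min_le_right _ _
      _ = (‖A‖ / (‖A‖ + 1)) * (τ / 2) := by field_simp
      _ ≤ 1 * (τ / 2) := by
        gcongr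
        rw [div_le_one (by positivity)]; linarith
      _ = τ / 2 := one_mul _
  have hν0 : ν (ball 0 τ) ≠ 0 := (measure_ball_pos ν 0 hτ0).ne'
  have hνt : ν (ball 0 τ) ≠ ⊤ := measure_ball_lt_top.ne
  refine ⟨μ (ball s₀ ρ₁) / ν (ball 0 τ),
    ENNReal.div_ne_zero.2 ⟨(measure_ball_pos μ s₀ hρ₁0).ne', hνt⟩, τ / 2, half_pos hτ0,
    fun B hBsub hB => ?_⟩
  set D : Set (E × F) := {p | p.1 ∈ ball s₀ ρ₁ ∧ p.2 ∈ ball (0 : F) τ ∧ A p.1 + p.2 ∈ B} with hD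
  have hDm : MeasurableSet D := by
    refine (measurable_fst measurableSet_ball).inter ((measurable_snd measurableSet_ball).inter ?_)
    exact ((A.continuous.measurable.comp measurable_fst).add measurable_snd) hB
  have h1 : μ (ball s₀ ρ₁) * ν B ≤ (μ.prod ν) D := by
    rw [Measure.prod_apply hDm, mul_comm, ← setLIntegral_const,
      ← lintegral_indicator measurableSet_ball]
    refine lintegral_mono fun s => ?_
    by_cases hs : s ∈ ball s₀ ρ₁
    · rw [indicator_of_mem hs]
      have : (fun y => A s + y) ⁻¹' B ⊆ Prod.mk s ⁻¹' D := by
        intro y hy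
        refine ⟨hs, ?_, hy⟩
        have e1 : dist (A s + y) (A s₀) < τ / 2 := hBsub hy
        have e2 : ‖A s - A s₀‖ ≤ τ / 2 := by
          rw [← map_sub]
          refine (A.le_opNorm _).trans (le_trans ?_ hAρ)
          gcongr
          rw [← dist_eq_norm]
          exact (mem_ball.1 hs).le
        rw [dist_eq_norm] at e1
        rw [mem_ball_zero_iff]
        calc ‖y‖ = ‖(A s + y - A s₀) - (A s - A s₀)‖ := by congr 1; abel
          _ ≤ ‖A s + y - A s₀‖ + ‖A s - A s₀‖ := norm_sub_le _ _
          _ < τ := by linarith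
      calc ν B = ν ((fun y => A s + y) ⁻¹' B) := (measure_preimage_add ν (A s) B).symm
        _ ≤ _ := measure_mono this
    · rw [indicator_of_notMem hs]
      exact zero_le
  have h2 : (μ.prod ν) D ≤ μ (ball s₀ ρ ∩ A ⁻¹' B) * ν (ball 0 τ) := by
    rw [Measure.prod_apply_symm hDm, ← setLIntegral_const, ← lintegral_indicator measurableSet_ball]
    refine lintegral_mono fun y => ?_
    by_cases hy : y ∈ ball (0 : F) τ
    · rw [indicator_of_mem hy]
      have : (fun s => (s, y)) ⁻¹' D ⊆ (fun s => s + R y) ⁻¹' (ball s₀ ρ ∩ A ⁻¹' B) := by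
        rintro s ⟨hs, -, hB'⟩
        refine ⟨?_, ?_⟩
        · have e1 : dist s s₀ < ρ / 2 := (mem_ball.1 hs).trans_le (min_le_left _ _)
          have e2 : ‖R y‖ ≤ ρ / 2 := by
            refine (R.le_opNorm _).trans (le_trans ?_ hRτ)
            gcongr
            exact (mem_ball_zero_iff.1 hy).le
          rw [dist_eq_norm] at e1
          rw [mem_ball, dist_eq_norm]
          calc ‖s + R y - s₀‖ = ‖(s - s₀) + R y‖ := by congr 1; abel
            _ ≤ ‖s - s₀‖ + ‖R y‖ := norm_add_le _ _
            _ < ρ := by linarith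
        · simpa [map_add, hAR] using hB'
      refine (measure_mono this).trans (le_of_eq (measure_preimage_add_right μ (R y) _))
    · rw [indicator_of_notMem hy]
      refine le_of_eq (measure_mono_null (t := ∅) (fun s hs => hy hs.2.1) measure_empty)
  rw [← ENNReal.mul_div_right_comm]
  exact ENNReal.div_le_of_le_mul (h1.trans h2)

/-- Let `G` be strictly differentiable at `(0, x₀)`, with surjective partial derivative `A` in the
first variable, and let `O` be an open set whose closure contains `0`. Then for `x` near `x₀` the
image of Lebesgue measure on `O` under `G(·, x)` has a density bounded below on a ball that does not
depend on `x`. With `R` a right inverse of `A`, the map `Ξ t = t + R (G (t, x) - A t)` is close to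
the identity on a small ball and satisfies `A (Ξ t) = G (t, x)`, which reduces the claim to `A`. -/
lemma exists_mul_measure_le_measure_preimage_of_hasStrictFDerivAt
    (μ : Measure E) [μ.IsAddHaarMeasure] (ν : Measure F) [ν.IsAddHaarMeasure]
    {G : E × X → F} (hG : Continuous G) {x₀ : X} {G' : E × X →L[ℝ] F}
    (hG' : HasStrictFDerivAt G G' (0, x₀)) (R : F →L[ℝ] E) (hR : ∀ y, G' (R y, 0) = y)
    {O : Set E} (hO : IsOpen O) (h0 : (0 : E) ∈ closure O) :
    ∃ (z : F) (c : ℝ≥0∞), c ≠ 0 ∧ ∃ δ > (0 : ℝ), ∀ᶠ x in 𝓝 x₀, ∀ B ⊆ ball z δ, MeasurableSet B →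
      c * ν B ≤ μ (O ∩ {t | G (t, x) ∈ B}) := by
  set A : E →L[ℝ] F := G'.comp (ContinuousLinearMap.inl ℝ E X) with hA
  have hAR : ∀ y, A (R y) = y := hR
  -- `κ < 1 / 2` controls the image of balls under `Ξ`, and the other bound the image of volume.
  obtain ⟨κ, hκvol, hκ0, hκ2⟩ : ∃ κ : ℝ≥0, (∀ (s : Set E) (g : E → E),
      ApproximatesLinearOn g (ContinuousLinearMap.id ℝ E) s κ → μ (g '' s) ≤ (2 : ℝ≥0) * μ s) ∧
      0 < κ ∧ κ < 1 / 2 := by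
    have h := addHaar_image_le_mul_of_det_lt μ (ContinuousLinearMap.id ℝ E) (m := 2)
      (by simp [ContinuousLinearMap.det])
    obtain ⟨κ, h1, h2⟩ := (h.and (Ioo_mem_nhdsGT (show (0 : ℝ≥0) < 1 / 2 by positivity))).exists
    exact ⟨κ, h1, h2.1, h2.2⟩
  set c₀ : ℝ≥0 := κ / (‖R‖₊ + 1) with hc₀
  have hc₀0 : 0 < c₀ := by positivity
  have hRc : ‖R‖ * c₀ ≤ κ := by
    rw [hc₀]
    push_cast
    calc ‖R‖ * ((κ : ℝ) / (‖R‖ + 1)) = (‖R‖ / (‖R‖ + 1)) * κ := by field_simp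
      _ ≤ 1 * κ := by
        gcongr
        rw [div_le_one (by positivity)]; linarith
      _ = κ := one_mul _
  obtain ⟨s, hs, happ⟩ := hG'.approximates_deriv_on_nhds (Or.inr hc₀0)
  obtain ⟨r, hr, hrs⟩ := Metric.mem_nhds_iff.1 hs
  -- The strict derivative at `0` still approximates near a point `t₀` of `O`.
  obtain ⟨t₀, ht₀r, ht₀O⟩ := mem_closure_iff.1 h0 (ball 0 r) isOpen_ball (mem_ball_self hr)
  obtain ⟨ρ, hρ, hρsub⟩ := Metric.nhds_basis_closedBall.mem_iff.1
    ((isOpen_ball.inter hO).mem_nhds ⟨ht₀r, ht₀O⟩)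
  set Ξ : X → E → E := fun x t => t + R (G (t, x) - A t) with hΞ
  have hAΞ : ∀ x t, A (Ξ x t) = G (t, x) := fun x t => by simp [hΞ, hAR]
  have hΞapp : ∀ x ∈ ball x₀ r, ∀ V ⊆ closedBall t₀ ρ,
      ApproximatesLinearOn (Ξ x) (ContinuousLinearMap.id ℝ E) V κ := by
    intro x hx V hV t ht t' ht'
    have hmem : ∀ u ∈ V, (u, x) ∈ s := fun u hu => hrs (by
      rw [mem_ball, Prod.dist_eq]
      exact max_lt (hρsub (hV hu)).1 hx)
    have h1 := happ (t, x) (hmem t ht) (t', x) (hmem t' ht')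
    have h2 : Ξ x t - Ξ x t' - ContinuousLinearMap.id ℝ E (t - t') =
        R (G (t, x) - G (t', x) - G' ((t, x) - (t', x))) := by
      have : G' ((t, x) - (t', x)) = A t - A t' := by
        rw [← map_sub, hA]
        simp
      rw [this]
      simp only [hΞ, map_sub, ContinuousLinearMap.id_apply]
      abel
    rw [h2]
    have h3 : ‖((t, x) : E × X) - (t', x)‖ = ‖t - t'‖ := by simp [Prod.norm_def]
    rw [h3] at h1
    calc _ ≤ ‖R‖ * (c₀ * ‖t - t'‖) := (R.le_opNorm _).trans (by gcongr)
      _ = (‖R‖ * c₀) * ‖t - t'‖ := by ring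
      _ ≤ κ * ‖t - t'‖ := by gcongr
  obtain ⟨c, hc, δ, hδ, hlin⟩ := exists_mul_measure_le_measure_preimage_linear μ ν A R hAR
    (Ξ x₀ t₀) (ρ := ρ / 4) (by positivity)
  refine ⟨A (Ξ x₀ t₀), c / 2, ENNReal.div_ne_zero.2 ⟨hc, by simp⟩, δ, hδ, ?_⟩
  have hΞcont : Continuous fun x => Ξ x t₀ :=
    continuous_const.add (R.continuous.comp ((hG.comp (Continuous.prodMk_right t₀)).sub
      continuous_const))
  have hnear : ∀ᶠ x in 𝓝 x₀, dist (Ξ x t₀) (Ξ x₀ t₀) < ρ / 4 :=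
    (hΞcont.tendsto x₀).eventually (ball_mem_nhds _ (by positivity))
  filter_upwards [hnear, ball_mem_nhds x₀ hr] with x hx hxr B hBsub hB
  set Rid : (ContinuousLinearMap.id ℝ E).NonlinearRightInverse :=
    { toFun := id, nnnorm := 1, bound' := by simp, right_inv' := fun _ => rfl } with hRid
  have hsurj : SurjOn (Ξ x) (closedBall t₀ ρ) (closedBall (Ξ x t₀) (ρ / 2)) := by
    refine ((hΞapp x hxr _ subset_rfl).surjOn_closedBall_of_nonlinearRightInverse Rid hρ.le
      subset_rfl).mono subset_rfl (closedBall_subset_closedBall ?_)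
    have : (κ : ℝ) < 1 / 2 := by exact_mod_cast hκ2
    simp only [hRid, NNReal.coe_one, inv_one]
    nlinarith
  have hsub : ball (Ξ x₀ t₀) (ρ / 4) ∩ A ⁻¹' B ⊆
      Ξ x '' (closedBall t₀ ρ ∩ {t | G (t, x) ∈ B}) := by
    rintro y ⟨hy, hyB⟩
    obtain ⟨t, ht, rfl⟩ := hsurj (show y ∈ closedBall (Ξ x t₀) (ρ / 2) by
      rw [mem_closedBall]
      have := dist_triangle y (Ξ x₀ t₀) (Ξ x t₀)
      rw [dist_comm (Ξ x₀ t₀)] at this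
      have := mem_ball.1 hy
      linarith)
    refine ⟨t, ⟨ht, ?_⟩, rfl⟩
    rw [mem_preimage, hAΞ] at hyB
    exact hyB
  have hle : c * ν B ≤ 2 * μ (O ∩ {t | G (t, x) ∈ B}) :=
    calc c * ν B ≤ μ (ball (Ξ x₀ t₀) (ρ / 4) ∩ A ⁻¹' B) := hlin B hBsub hB
      _ ≤ μ (Ξ x '' (closedBall t₀ ρ ∩ {t | G (t, x) ∈ B})) := measure_mono hsub
      _ ≤ (2 : ℝ≥0) * μ (closedBall t₀ ρ ∩ {t | G (t, x) ∈ B}) :=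
          hκvol _ _ (hΞapp x hxr _ inter_subset_left)
      _ ≤ 2 * μ (O ∩ {t | G (t, x) ∈ B}) :=
          mul_le_mul_right (measure_mono (inter_subset_inter_left _ fun t ht => (hρsub ht).2)) _
  rw [← ENNReal.mul_div_right_comm]
  exact ENNReal.div_le_of_le_mul (by rwa [mul_comm _ (2 : ℝ≥0∞)])

end Submersion

/-! ### Skeletons and iterates of the jump kernel -/

section Skeleton

variable {N : ℕ} {b : Conf N → Conf N} {a : Fin N → Conf N → Conf N} {f : Fin N → Conf N → ℝ}

/-- The state of the jump chain after `m` steps when the successive jumps are those of particles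
`i 0, …, i (m - 1)` and the successive waiting times are `t 0, …, t (m - 1)`. Unlike in
`skeletonEnd`, the path begins with a jump, and the recursion peels off the first step. -/
noncomputable def chainEnd (b : Conf N → Conf N) (a : Fin N → Conf N → Conf N) :
    (m : ℕ) → (Fin m → Fin N) → (Fin m → ℝ) → Conf N → Conf N
  | 0, _, _, x => x
  | m + 1, i, t, x => chainEnd b a m (fun j => i j.succ) (fun j => t j.succ)
      (flow b (t 0) (afterJump a (i 0) x))

lemma skeletonConf_succ {n : ℕ} (y : Conf N) (t : Fin (n + 2) → ℝ) (i : Fin (n + 2) → Fin N)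
    (k : Fin (n + 1)) :
    skeletonConf b a y t i k.succ =
      skeletonConf b a (afterJump a (i 1) (flow b (t 0) y)) (fun j => t j.succ)
        (fun j => i j.succ) k := by
  induction k using Fin.induction with
  | zero => rfl
  | succ k ih =>
    change afterJump a (i k.succ.succ) (flow b (t k.succ.castSucc)
      (skeletonConf b a y t i k.succ.castSucc)) = afterJump a (i k.succ.succ)
        (flow b (t k.castSucc.succ) (skeletonConf b a (afterJump a (i 1) (flow b (t 0) y))
          (fun j => t j.succ) (fun j => i j.succ) k.castSucc))
    rw [← ih]
    rfl

lemma skeletonEnd_eq_chainEnd {n : ℕ} (y : Conf N) (t : Fin (n + 1) → ℝ)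
    (i : Fin (n + 1) → Fin N) :
    skeletonEnd b a y t i =
      chainEnd b a n (fun j => i j.succ) (fun j => t j.succ) (flow b (t 0) y) := by
  induction n generalizing y with
  | zero => rfl
  | succ n ih =>
    have h := ih (afterJump a (i 1) (flow b (t 0) y)) (fun j => t j.succ) (fun j => i j.succ)
    refine Eq.trans ?_ h
    unfold skeletonEnd
    rw [← skeletonConf_succ]
    rfl

lemma chainEnd_succ_eq_skeletonEnd {n : ℕ} (x : Conf N) (t : Fin (n + 1) → ℝ)
    (i : Fin (n + 1) → Fin N) :
    chainEnd b a (n + 1) i t x = skeletonEnd b a (afterJump a (i 0) x) t i :=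
  (skeletonEnd_eq_chainEnd _ t i).symm

lemma continuous_chainEnd (hF : Continuous fun p : ℝ × Conf N => flow b p.1 p.2)
    (ha : ∀ i, Continuous (a i)) (m : ℕ) (i : Fin m → Fin N) :
    Continuous fun p : (Fin m → ℝ) × Conf N => chainEnd b a m i p.1 p.2 := by
  induction m with
  | zero => exact continuous_snd
  | succ m ih =>
    refine (ih fun j => i j.succ).comp (Continuous.prodMk ?_ (hF.comp (Continuous.prodMk ?_ ?_)))
    · exact continuous_pi fun j => (continuous_apply j.succ).comp continuous_fst
    · exact (continuous_apply 0).comp continuous_fst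
    · exact continuous_snd.add ((ha (i 0)).comp continuous_snd)

lemma exists_hasStrictFDerivAt_chainEnd {K : ℝ≥0} (hb : ContDiff ℝ 1 b) (hK : LipschitzWith K b)
    (ha : ∀ i, ContDiff ℝ 1 (a i)) (m : ℕ) (i : Fin m → Fin N) (z : Conf N) :
    ∃ G' : (Fin m → ℝ) × Conf N →L[ℝ] Conf N,
      HasStrictFDerivAt (fun p : (Fin m → ℝ) × Conf N => chainEnd b a m i p.1 p.2) G' (0, z) := by
  induction m generalizing z with
  | zero => exact ⟨ContinuousLinearMap.snd ℝ _ _, hasStrictFDerivAt_snd⟩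
  | succ m ih =>
    obtain ⟨G', hG'⟩ := ih (fun j => i j.succ) (afterJump a (i 0) z)
    have hΔ : HasStrictFDerivAt (fun p : (Fin (m + 1) → ℝ) × Conf N => afterJump a (i 0) p.2) _
        (0, z) :=
      HasStrictFDerivAt.comp (g := afterJump a (i 0)) (0, z)
        ((hasStrictFDerivAt_id z).add ((ha (i 0)).contDiffAt.hasStrictFDerivAt one_ne_zero))
        (hasStrictFDerivAt_snd (p := ((0 : Fin (m + 1) → ℝ), z)))
    have h0 : HasStrictFDerivAt (fun p : (Fin (m + 1) → ℝ) × Conf N => p.1 0) _ (0, z) :=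
      ((ContinuousLinearMap.proj (R := ℝ) (φ := fun _ : Fin (m + 1) => ℝ) 0).comp
        (ContinuousLinearMap.fst ℝ (Fin (m + 1) → ℝ) (Conf N))).hasStrictFDerivAt
    have htail : HasStrictFDerivAt
        (fun p : (Fin (m + 1) → ℝ) × Conf N => fun j : Fin m => p.1 j.succ) _ (0, z) :=
      ((ContinuousLinearMap.pi fun j : Fin m =>
        ContinuousLinearMap.proj (R := ℝ) (φ := fun _ : Fin (m + 1) => ℝ) j.succ).comp
        (ContinuousLinearMap.fst ℝ (Fin (m + 1) → ℝ) (Conf N))).hasStrictFDerivAt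
    have hfl : HasStrictFDerivAt
        (fun p : (Fin (m + 1) → ℝ) × Conf N => flow b (p.1 0) (afterJump a (i 0) p.2)) _ (0, z) :=
      HasStrictFDerivAt.comp (g := fun q : ℝ × Conf N => flow b q.1 q.2) (0, z)
        (hasStrictFDerivAt_flow hb hK (afterJump a (i 0) z)) (h0.prodMk hΔ)
    have hG0 : HasStrictFDerivAt
        (fun p : (Fin m → ℝ) × Conf N => chainEnd b a m (fun j => i j.succ) p.1 p.2) G'
        (0, flow b 0 (afterJump a (i 0) z)) := by
      rwa [flow_zero hb hK]
    exact ⟨_, HasStrictFDerivAt.comp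
      (g := fun p : (Fin m → ℝ) × Conf N => chainEnd b a m (fun j => i j.succ) p.1 p.2)
      (f := fun p : (Fin (m + 1) → ℝ) × Conf N =>
        ((fun j : Fin m => p.1 j.succ), flow b (p.1 0) (afterJump a (i 0) p.2)))
      (0, z) hG0 (htail.prodMk hfl)⟩

/-- Near `z₀`, the `m`-step kernel dominates a multiple of the image, under the path map
`chainEnd`, of Lebesgue measure on a small box of positive waiting times. -/
lemma exists_mul_volume_chainEnd_le_iterKernel {K : ℝ≥0} (hb : ContDiff ℝ 1 b)
    (hK : LipschitzWith K b) (ha : ∀ i, Continuous (a i)) (hf : ∀ i, Continuous (f i))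
    (hfpos : ∀ i x, 0 < f i x) (hN : 0 < N)
    (hrate : ∀ x, ∫⁻ s in Ioi (0 : ℝ), ENNReal.ofReal (totalRate f (flow b s x)) = ⊤)
    (m : ℕ) (i : Fin m → Fin N) (z₀ : Conf N) :
    ∃ c : ℝ≥0∞, c ≠ 0 ∧ ∃ ε > (0 : ℝ), ∀ᶠ x in 𝓝 z₀, ∀ B, MeasurableSet B →
      c * volume {t : Fin m → ℝ | t ∈ univ.pi (fun _ => Ioo 0 ε) ∧ chainEnd b a m i t x ∈ B} ≤
        iterKernel (jumpKernel b a f) m x B := by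
  have hF := continuous_flow hb hK
  have hpos : ∀ x, 0 < totalRate f x := fun x =>
    Finset.sum_pos (fun j _ => hfpos j x) ⟨⟨0, hN⟩, Finset.mem_univ _⟩
  have hker := measurable_jumpKernel hF ha hf hpos hrate
  induction m generalizing z₀ with
  | zero =>
    refine ⟨1, one_ne_zero, 1, one_pos, Eventually.of_forall fun x B hB => ?_⟩
    simp only [iterKernel, chainEnd, one_mul]
    rw [Measure.dirac_apply' x hB]
    by_cases hx : x ∈ B
    · simp [hx, volume_pi]
    · simp [hx]
  | succ m ih =>
    obtain ⟨c', hc', ε', hε', hx'⟩ := ih (fun j => i j.succ) (afterJump a (i 0) z₀)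
    obtain ⟨c, hc, hstep⟩ := exists_smul_map_flow_le_jumpKernel hF ha hf hfpos hrate z₀ (i 0)
    have hΔ : Continuous (afterJump a (i 0)) := continuous_id.add (ha (i 0))
    have hcont : Tendsto (fun p : ℝ × Conf N => flow b p.1 (afterJump a (i 0) p.2)) (𝓝 (0, z₀))
        (𝓝 (afterJump a (i 0) z₀)) := by
      have : Continuous fun p : ℝ × Conf N => flow b p.1 (afterJump a (i 0) p.2) :=
        hF.comp (continuous_fst.prodMk (hΔ.comp continuous_snd))
      simpa [flow_zero hb hK] using this.tendsto (0, z₀)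
    obtain ⟨r, hr, hball⟩ := Metric.eventually_nhds_iff_ball.1 (hcont.eventually hx')
    obtain ⟨ε, hε1, hε2, hε3⟩ := (hstep.and (Ioo_mem_nhdsGT (lt_min hr hε'))).exists
    refine ⟨ENNReal.ofReal c * c', mul_ne_zero (by simpa using hc) hc', ε, hε2, ?_⟩
    filter_upwards [hε1, ball_mem_nhds z₀ hr] with x hx hxr B hB
    set T' : Set (ℝ × (Fin m → ℝ)) := {p | p.1 ∈ Ioo 0 ε ∧ p.2 ∈ univ.pi (fun _ => Ioo 0 ε) ∧
      chainEnd b a m (fun j => i j.succ) p.2 (flow b p.1 (afterJump a (i 0) x)) ∈ B} with hT'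
    have hflowm : Measurable fun s => flow b s (afterJump a (i 0) x) :=
      (hF.comp (Continuous.prodMk_left _)).measurable
    have hT'm : MeasurableSet T' := by
      refine (measurable_fst measurableSet_Ioo).inter
        ((measurable_snd (MeasurableSet.univ_pi fun _ => measurableSet_Ioo)).inter ?_)
      exact ((continuous_chainEnd hF ha m fun j => i j.succ).measurable.comp
        (measurable_snd.prodMk (hflowm.comp measurable_fst))) hB
    have hpre : {t : Fin (m + 1) → ℝ | t ∈ univ.pi (fun _ => Ioo 0 ε) ∧
        chainEnd b a (m + 1) i t x ∈ B} =
        MeasurableEquiv.piFinSuccAbove (fun _ : Fin (m + 1) => ℝ) 0 ⁻¹' T' := by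
      ext t
      simp only [hT', mem_ofPred_eq, mem_preimage, mem_univ_pi, Fin.forall_fin_succ,
        MeasurableEquiv.piFinSuccAbove_apply, Fin.insertNthEquiv_zero, Fin.consEquiv_symm_apply,
        chainEnd, and_assoc]
      rfl
    have hvol : volume {t : Fin (m + 1) → ℝ | t ∈ univ.pi (fun _ => Ioo 0 ε) ∧
        chainEnd b a (m + 1) i t x ∈ B} = ∫⁻ s in Ioo 0 ε, volume (Prod.mk s ⁻¹' T') := by
      rw [hpre, (volume_preserving_piFinSuccAbove
          (fun _ : Fin (m + 1) => ℝ) 0).measure_preimage_equiv,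
        Measure.volume_eq_prod, Measure.prod_apply hT'm,
        ← lintegral_indicator measurableSet_Ioo]
      refine lintegral_congr fun s => ?_
      by_cases hs : s ∈ Ioo 0 ε
      · rw [indicator_of_mem hs]
      · rw [indicator_of_notMem hs]
        refine measure_mono_null (t := ∅) (fun t ht => hs ht.1) measure_empty
    have hiter := measurable_iterKernel hker m
    have hiterB : Measurable fun y => iterKernel (jumpKernel b a f) m y B :=
      (Measure.measurable_coe hB).comp hiter
    calc ENNReal.ofReal c * c' * volume {t : Fin (m + 1) → ℝ | t ∈ univ.pi (fun _ => Ioo 0 ε) ∧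
          chainEnd b a (m + 1) i t x ∈ B}
        = ENNReal.ofReal c * ∫⁻ s in Ioo 0 ε, c' * volume (Prod.mk s ⁻¹' T') := by
          rw [hvol, lintegral_const_mul _ (measurable_measure_prodMk_left hT'm), mul_assoc]
      _ ≤ ENNReal.ofReal c * ∫⁻ s in Ioo 0 ε,
            iterKernel (jumpKernel b a f) m (flow b s (afterJump a (i 0) x)) B := by
          refine mul_le_mul_right (setLIntegral_mono' measurableSet_Ioo fun s hs => ?_) _
          refine le_trans (mul_le_mul_right (measure_mono ?_) _) (hball (s, x) ?_ B hB)
          · rintro t ⟨_, ht, htB⟩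
            refine ⟨fun j hj => ⟨(ht j hj).1, (ht j hj).2.trans (hε3.trans_le (min_le_right _ _))⟩,
              htB⟩
          · rw [mem_ball, Prod.dist_eq]
            refine max_lt ?_ hxr
            simpa [abs_of_pos hs.1] using hs.2.trans (hε3.trans_le (min_le_left _ _))
      _ = ∫⁻ y, iterKernel (jumpKernel b a f) m y B ∂(ENNReal.ofReal c •
            (volume.restrict (Ioo 0 ε)).map (fun s => flow b s (afterJump a (i 0) x))) := by
          rw [lintegral_smul_measure, lintegral_map hiterB hflowm, smul_eq_mul]
      _ ≤ ∫⁻ y, iterKernel (jumpKernel b a f) m y B ∂(jumpKernel b a f x) :=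
          lintegral_mono' hx le_rfl
      _ = iterKernel (jumpKernel b a f) (m + 1) x B :=
          (Measure.bind_apply hB hiter.aemeasurable).symm

end Skeleton

/-! ### The derivation matrix and the minorization -/

section Minorization

variable {N : ℕ} {b : Conf N → Conf N} {a : Fin N → Conf N → Conf N}

/-- At `t = 0` the derivation matrix is the matrix of the partial derivative of the path map. -/
lemma derivationMatrix_mulVec {n : ℕ} (i : Fin (n + 1) → Fin N) (z : Conf N)
    {G' : (Fin (n + 1) → ℝ) × Conf N →L[ℝ] Conf N}
    (hG' : HasFDerivAt (fun p : (Fin (n + 1) → ℝ) × Conf N => chainEnd b a (n + 1) i p.1 p.2)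
      G' (0, z)) (v : Fin (n + 1) → ℝ) (k : Fin N) :
    (derivationMatrix b a (afterJump a (i 0) z) 0 i).mulVec v k = G' (v, 0) k := by
  have hentry : ∀ j, derivationMatrix b a (afterJump a (i 0) z) 0 i k j =
      G' (Pi.single j 1, 0) k := by
    intro j
    have hu : HasDerivAt (fun r : ℝ => (Function.update (0 : Fin (n + 1) → ℝ) j r, z))
        (Pi.single j 1, 0) 0 :=
      (hasDerivAt_update (0 : Fin (n + 1) → ℝ) j 0).prodMk (hasDerivAt_const 0 z)
    have h0 : HasFDerivAt (fun p : (Fin (n + 1) → ℝ) × Conf N => chainEnd b a (n + 1) i p.1 p.2)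
        G' (Function.update (0 : Fin (n + 1) → ℝ) j 0, z) := by
      rwa [show Function.update (0 : Fin (n + 1) → ℝ) j 0 = 0 from Function.update_eq_self j 0]
    have h1 : HasDerivAt (fun r : ℝ => chainEnd b a (n + 1) i
        (Function.update (0 : Fin (n + 1) → ℝ) j r) z) (G' (Pi.single j 1, 0)) 0 :=
      HasFDerivAt.comp_hasDerivAt (f := fun r : ℝ => (Function.update (0 : Fin (n + 1) → ℝ) j r, z))
        (0 : ℝ) h0 hu
    have h2 : HasDerivAt (fun r : ℝ => chainEnd b a (n + 1) i
        (Function.update (0 : Fin (n + 1) → ℝ) j r) z k) (G' (Pi.single j 1, 0) k) 0 :=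
      (EuclideanSpace.proj (𝕜 := ℝ) k).hasFDerivAt.comp_hasDerivAt (0 : ℝ) h1
    simp only [chainEnd_succ_eq_skeletonEnd] at h2
    exact h2.hasDerivWithinAt.derivWithin (uniqueDiffOn_Ici 0 0 self_mem_Ici)
  have hsum : G' (v, 0) = ∑ j, v j • G' (Pi.single j 1, 0) := by
    have := LinearMap.pi_apply_eq_sum_univ
      (G'.comp (ContinuousLinearMap.inl ℝ (Fin (n + 1) → ℝ) (Conf N))).toLinearMap v
    simp only [ContinuousLinearMap.coe_coe, ContinuousLinearMap.comp_apply,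
      ContinuousLinearMap.inl_apply] at this
    rw [this]
    refine Finset.sum_congr rfl fun j _ => ?_
    congr 4
    ext l
    simp [Pi.single_apply, eq_comm]
  rw [hsum, Matrix.mulVec, dotProduct]
  simp only [WithLp.ofLp_sum, WithLp.ofLp_smul, Finset.sum_apply, Pi.smul_apply, smul_eq_mul,
    hentry]
  exact Finset.sum_congr rfl fun j _ => mul_comm _ _

/-- A matrix `σ` with `det (σ σᵀ) ≠ 0` has the right inverse `σᵀ (σ σᵀ)⁻¹`. -/
lemma exists_rightInverse_of_det_ne_zero {m : ℕ} (σ : Matrix (Fin N) (Fin m) ℝ)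
    (hσ : (σ * σ.transpose).det ≠ 0) :
    ∃ R : Conf N →L[ℝ] (Fin m → ℝ), ∀ y k, σ.mulVec (R y) k = y k := by
  refine ⟨LinearMap.toContinuousLinearMap ((σ.transpose * (σ * σ.transpose)⁻¹).toLin' ∘ₗ
    (WithLp.linearEquiv 2 ℝ (Fin N → ℝ)).toLinearMap), fun y k => ?_⟩
  simp only [LinearMap.coe_toContinuousLinearMap', LinearMap.comp_apply, Matrix.toLin'_apply,
    LinearEquiv.coe_coe, Matrix.mulVec_mulVec]
  rw [← Matrix.mul_assoc, Matrix.mul_nonsing_inv _ (isUnit_iff_ne_zero.2 hσ), Matrix.one_mulVec]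
  rfl

/-- On finite-dimensional space, Lebesgue measure on a ball dominates a multiple of a smooth
probability density. -/
lemma exists_smooth_density_le (z : Conf N) {δ : ℝ} (hδ : 0 < δ) {c : ℝ≥0∞} (hc : c ≠ 0) :
    ∃ (β : ℝ) (ν : Conf N → ℝ), β ∈ Ioo (0 : ℝ) 1 ∧
      ContDiff ℝ ∞ ν ∧ (∀ y, 0 ≤ ν y) ∧ ∫ y, ν y = 1 ∧ HasCompactSupport ν ∧
      tsupport ν ⊆ ball z δ ∧ ∀ B, MeasurableSet B →
        ENNReal.ofReal β * ∫⁻ y in B, ENNReal.ofReal (ν y) ≤ c * volume (B ∩ ball z δ) := by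
  set φ : ContDiffBump z := ⟨δ / 4, δ / 2, by positivity, by linarith⟩ with hφ
  obtain ⟨M, hM⟩ := (φ.hasCompactSupport_normed (μ := volume)).exists_bound_of_continuous
    φ.continuous_normed
  have hsupp : tsupport (φ.normed volume) ⊆ ball z δ := by
    rw [φ.tsupport_normed_eq]
    exact closedBall_subset_ball (by simp only [hφ]; linarith)
  obtain ⟨β, hβ, hβc⟩ : ∃ β ∈ Ioo (0 : ℝ) 1, ENNReal.ofReal β * ENNReal.ofReal M ≤ c := by
    have hlim : Tendsto (fun β : ℝ => ENNReal.ofReal (β * M)) (𝓝[>] 0) (𝓝 0) := by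
      have : Continuous fun β : ℝ => ENNReal.ofReal (β * M) :=
        ENNReal.continuous_ofReal.comp (continuous_id.mul continuous_const)
      simpa using (this.tendsto 0).mono_left nhdsWithin_le_nhds
    obtain ⟨β, h1, h2⟩ := ((hlim.eventually (Iic_mem_nhds (pos_iff_ne_zero.2 hc))).and
      (Ioo_mem_nhdsGT one_pos)).exists
    exact ⟨β, h2, by rwa [← ENNReal.ofReal_mul h2.1.le]⟩
  refine ⟨β, φ.normed volume, hβ, φ.contDiff_normed, φ.nonneg_normed, φ.integral_normed,
    φ.hasCompactSupport_normed, hsupp, fun B hB => ?_⟩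
  have hle : ∀ y, ENNReal.ofReal (φ.normed volume y) ≤
      (ball z δ).indicator (fun _ => ENNReal.ofReal M) y := by
    intro y
    by_cases hy : y ∈ ball z δ
    · rw [indicator_of_mem hy]
      exact ENNReal.ofReal_le_ofReal ((le_abs_self _).trans (hM y))
    · rw [image_eq_zero_of_notMem_tsupport fun h => hy (hsupp h)]
      simp
  calc ENNReal.ofReal β * ∫⁻ y in B, ENNReal.ofReal (φ.normed volume y)
      ≤ ENNReal.ofReal β * ∫⁻ y in B, (ball z δ).indicator (fun _ => ENNReal.ofReal M) y :=
        mul_le_mul_right (lintegral_mono hle) _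
    _ = ENNReal.ofReal β * ENNReal.ofReal M * volume (B ∩ ball z δ) := by
        rw [lintegral_indicator_const measurableSet_ball, Measure.restrict_apply measurableSet_ball,
          inter_comm, mul_assoc]
    _ ≤ c * volume (B ∩ ball z δ) := mul_le_mul_left hβc _

end Minorization

end JumpPDMP

theorem mainTheorem4 {N : ℕ}
    (b : JumpPDMP.Conf N → JumpPDMP.Conf N)
    (a : Fin N → JumpPDMP.Conf N → JumpPDMP.Conf N)
    (f : Fin N → JumpPDMP.Conf N → ℝ)
    (hb_smooth : ContDiff ℝ 1 b) (ha_smooth : ∀ i, ContDiff ℝ 1 (a i))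
    (hb_lip : ∃ L : ℝ≥0, LipschitzWith L b)
    (hf_lip : ∀ i, ∃ L : ℝ≥0, LipschitzWith L (f i))
    (hf_pos : ∀ i x, 0 < f i x)
    (h_rate : ∀ x, ∫⁻ s in Ioi (0 : ℝ),
      ENNReal.ofReal (JumpPDMP.totalRate f (JumpPDMP.flow b s x)) = ⊤)
    (n : ℕ) (i : Fin (n + 1) → Fin N)
    (h_good : 0 < ⨅ x₀ : JumpPDMP.Conf N,
      (JumpPDMP.derivationMatrix b a x₀ 0 i *
        (JumpPDMP.derivationMatrix b a x₀ 0 i).transpose).det) :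
    ∀ z₀ : JumpPDMP.Conf N, ∃ (zₙ : JumpPDMP.Conf N) (δ₁ δ₂ β : ℝ) (ν : JumpPDMP.Conf N → ℝ),
      0 < δ₁ ∧ 0 < δ₂ ∧ β ∈ Ioo (0 : ℝ) 1 ∧
      ContDiff ℝ ∞ ν ∧ (∀ y, 0 ≤ ν y) ∧ ∫ y, ν y = 1 ∧
      HasCompactSupport ν ∧ tsupport ν ⊆ Metric.ball zₙ δ₂ ∧
      ∀ (x : JumpPDMP.Conf N) (B : Set (JumpPDMP.Conf N)), MeasurableSet B →
        (Metric.ball z₀ δ₁).indicator (fun _ => ENNReal.ofReal β) x *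
            ∫⁻ y in B, ENNReal.ofReal (ν y) ≤
          JumpPDMP.iterKernel (JumpPDMP.jumpKernel b a f) (n + 1) x B := by
  intro z₀
  obtain ⟨K, hK⟩ := hb_lip
  have hf : ∀ i, Continuous (f i) := fun i => (hf_lip i).choose_spec.continuous
  have ha : ∀ i, Continuous (a i) := fun i => (ha_smooth i).continuous
  have hF := JumpPDMP.continuous_flow hb_smooth hK
  -- `det (σ σᵀ)` is nonnegative, so the infimum bounds it from below at `x₀ = Δ_{i₀}(z₀)`.
  have hdet : (JumpPDMP.derivationMatrix b a (JumpPDMP.afterJump a (i 0) z₀) 0 i *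
      (JumpPDMP.derivationMatrix b a (JumpPDMP.afterJump a (i 0) z₀) 0 i).transpose).det ≠ 0 := by
    refine (h_good.trans_le (ciInf_le ⟨0, ?_⟩ (JumpPDMP.afterJump a (i 0) z₀))).ne'
    rintro _ ⟨x, rfl⟩
    have := (Matrix.posSemidef_self_mul_conjTranspose
      (JumpPDMP.derivationMatrix b a x 0 i)).det_nonneg
    simpa [Matrix.conjTranspose_eq_transpose_of_trivial] using this
  obtain ⟨R, hR⟩ := JumpPDMP.exists_rightInverse_of_det_ne_zero _ hdet
  obtain ⟨G', hG'⟩ := JumpPDMP.exists_hasStrictFDerivAt_chainEnd hb_smooth hK ha_smooth (n + 1) i z₀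
  have hGR : ∀ y, G' (R y, 0) = y := fun y => by
    ext k
    rw [← JumpPDMP.derivationMatrix_mulVec i z₀ hG'.hasFDerivAt, hR]
  obtain ⟨c, hc, ε, hε, hiter⟩ :=
    JumpPDMP.exists_mul_volume_chainEnd_le_iterKernel hb_smooth hK ha hf hf_pos
      (Fin.pos (i 0)) h_rate (n + 1) i z₀
  obtain ⟨zₙ, c', hc', δ₂, hδ₂, hsub⟩ :=
    JumpPDMP.exists_mul_measure_le_measure_preimage_of_hasStrictFDerivAt
      (volume : Measure (Fin (n + 1) → ℝ)) (volume : Measure (JumpPDMP.Conf N))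
      (JumpPDMP.continuous_chainEnd hF ha (n + 1) i) hG' R hGR
      (O := univ.pi fun _ => Ioo 0 ε) (isOpen_set_pi finite_univ fun _ _ => isOpen_Ioo) (by
        rw [closure_pi_set]
        intro j _
        change (0 : ℝ) ∈ closure (Ioo 0 ε)
        rw [closure_Ioo hε.ne]
        exact left_mem_Icc.2 hε.le)
  obtain ⟨δ₁, hδ₁, hball⟩ := Metric.eventually_nhds_iff_ball.1 (hiter.and hsub)
  obtain ⟨β, ν, hβ, hν1, hν2, hν3, hν4, hν5, hν6⟩ :=
    JumpPDMP.exists_smooth_density_le zₙ hδ₂ (mul_ne_zero hc hc')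
  refine ⟨zₙ, δ₁, δ₂, β, ν, hδ₁, hδ₂, hβ, hν1, hν2, hν3, hν4, hν5, fun x B hB => ?_⟩
  by_cases hx : x ∈ Metric.ball z₀ δ₁
  · rw [indicator_of_mem hx]
    have hBm : MeasurableSet (B ∩ Metric.ball zₙ δ₂) := hB.inter measurableSet_ball
    calc ENNReal.ofReal β * ∫⁻ y in B, ENNReal.ofReal (ν y)
        ≤ c * (c' * volume (B ∩ Metric.ball zₙ δ₂)) := (hν6 B hB).trans_eq (mul_assoc _ _ _)
      _ ≤ c * volume {t : Fin (n + 1) → ℝ | t ∈ univ.pi (fun _ => Ioo 0 ε) ∧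
            JumpPDMP.chainEnd b a (n + 1) i t x ∈ B ∩ Metric.ball zₙ δ₂} :=
          mul_le_mul_right ((hball x hx).2 _ inter_subset_right hBm) _
      _ ≤ JumpPDMP.iterKernel (JumpPDMP.jumpKernel b a f) (n + 1) x (B ∩ Metric.ball zₙ δ₂) :=
          (hball x hx).1 _ hBm
      _ ≤ JumpPDMP.iterKernel (JumpPDMP.jumpKernel b a f) (n + 1) x B :=
          measure_mono inter_subset_left
  · rw [indicator_of_notMem hx, zero_mul]
    exact zero_le
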